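/- Let $p\ge 1$ and let $m$ be Lebesgue measure on $I=[0,1]$. For $f:I\to\mathbb C$ and $r>0$ put $\operatorname{osc}(f,r,x)=\sup\{|f(y_1)-f(y_2)| : y_1,y_2\in(x-r,x+r)\cap I\}$ and, for a constant $A>0$, $$\operatorname{var}(f)=\sup_{0<r\le A} r^{-1/p}\int_I \operatorname{osc}(f,r,x)\,dm(x);$$ for an $m$-equivalence class, $\operatorname{var}_{1,1/p}$ is the infimum of $\operatorname{var}$ over all versions. Let $BV_{1,1/p}$ be the space of classes $f\in L^1(I,m)$ with $\operatorname{var}_{1,1/p}(f)<\infty$, and let $\|f\|_{1,1/p}=\operatorname{var}_{1,1/p}(f)+\|f\|_1$ (both $\operatorname{var}_{1,1/p}$ and the norm depend on $A$). Let $0=a_0<a_1<\dots<a_q=1$, $I_i=(a_{i-1},a_i)$, and let $\tau:I\to I$ be such that for each $i$: $\tau|_{I_i}$ is monotonic, $C^1$, and extends to a $C^1$ function on $\overline{I_i}$; there is $M_i$ with $|\tau'(x)-\tau'(y)|\le M_i|x-y|^{1/p}$ for $x,y\in I_i$; and $|\tau'(x)|\ge s_i>1$ for $x\in I_i$. Put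 $s=\min_i s_i$ and let $$P_\tau f(x)=\sum_{i=1}^q \frac{f(\tau_i^{-1}(x))}{|\tau'(\tau_i^{-1}(x))|}\,\chi_{\tau(I_i)}(x),\qquad \tau_i=\tau|_{I_i},$$ be the Frobenius–Perron operator. Then: (1) For every $A>0$ there are $\alpha,\beta>0$ such that for every $f\in BV_{1,1/p}$ one has $P_\tau f\in BV_{1,1/p}$ and $\operatorname{var}_{1,1/p}(P_\tau f)\le\alpha\operatorname{var}_{1,1/p}(f)+\beta\|f\|_1$. (2) For every $\alpha>s^{-1/p}+s^{-1}$ there is $A_0>0$ such that for every $A\in(0,A_0]$ there is $\beta>0$ with $\operatorname{var}_{1,1/p}(P_\tau f)\le\alpha\operatorname{var}_{1,1/p}(f)+\beta\|f\|_1$ for all $f\in BV_{1,1/p}$. (3) (Lasota–Yorke inequality) If $s^{-1/p}+s^{-1}<1$, then there is $A_0>0$ such that for every $A\in(0,A_0]$ there are $0<\alpha<1$ and $K>0$ such that for every $f\in BV_{1,1/p}$ one has $P_\tau f\in BV_{1,1/p}$ and $$\|P_\tau f\|_{1,1/p}\le\alpha\|f\|_{1,1/p}+K\|f\|_1 .$$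 -/

import Mathlib

open Set MeasureTheory
open scoped ENNReal

/-- Lebesgue measure on the unit interval `I = [0,1]`. Functions on `I` are written as functions on
`ℝ`; only their values on `I` are ever used. -/
noncomputable def lebI : Measure ℝ := volume.restrict (Icc (0 : ℝ) 1)

/-- The relative ball `S_r(x) = (x - r, x + r) ∩ I`. -/
def relBall (r x : ℝ) : Set ℝ := Ioo (x - r) (x + r) ∩ Icc 0 1

/-- The oscillation `osc(f, r, x) = sup_{y₁, y₂ ∈ S_r(x)} |f y₁ - f y₂|`. -/
noncomputable def osc (f : ℝ → ℂ) (r x : ℝ) : ℝ≥0∞ :=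
  ⨆ y₁ ∈ relBall r x, ⨆ y₂ ∈ relBall r x, ‖f y₁ - f y₂‖ₑ

/-- `osc₁(f, r) = ∫_I osc(f, r, x) dx`. -/
noncomputable def oscOne (f : ℝ → ℂ) (r : ℝ) : ℝ≥0∞ := ∫⁻ x, osc f r x ∂lebI

/-- The variation of an everywhere defined function,
`sup_{0 < r ≤ A} osc₁(f, r) / r^{1/p}`. -/
noncomputable def varFun (A p : ℝ) (f : ℝ → ℂ) : ℝ≥0∞ :=
  ⨆ r ∈ Ioc (0 : ℝ) A, oscOne f r / ENNReal.ofReal (r ^ (1 / p))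

/-- `var_{1,1/p}` of the `m`-equivalence class of `f`: the least variation of a version of `f`. -/
noncomputable def varClass (A p : ℝ) (f : ℝ → ℂ) : ℝ≥0∞ :=
  ⨅ (g : ℝ → ℂ) (_ : g =ᵐ[lebI] f), varFun A p g

/-- The class of `f` lies in `BV_{1,1/p}`: `f` is in `L¹(I)` and has a version of finite
variation. -/
def MemBV (A p : ℝ) (f : ℝ → ℂ) : Prop :=
  MemLp f 1 lebI ∧ varClass A p f < ∞

/-- The norm of `BV_{1,1/p}`: the variation plus the `L¹` norm. -/
noncomputable def bvNorm (A p : ℝ) (f : ℝ → ℂ) : ℝ≥0∞ :=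
  varClass A p f + eLpNorm f 1 lebI

/-- The `i`-th open interval `(a_i, a_{i+1})` of a partition `a_0 < a_1 < ⋯ < a_q`. -/
def piece {q : ℕ} (a : Fin (q + 1) → ℝ) (i : Fin q) : Set ℝ := Ioo (a i.castSucc) (a i.succ)

/-- `τ` is a piecewise expanding, piecewise `C^{1+ε}` map of `I = [0,1]` for the partition
`0 = a_0 < a_1 < ⋯ < a_q = 1` with lower slope bounds `s_i > 1`. -/
structure IsPiecewiseExpanding (ε : ℝ) (τ : ℝ → ℝ) {q : ℕ} (a : Fin (q + 1) → ℝ)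
    (s : Fin q → ℝ) : Prop where
  mapsTo : MapsTo τ (Icc 0 1) (Icc 0 1)
  strictMono : StrictMono a
  first : a 0 = 0
  last : a (Fin.last q) = 1
  monotone : ∀ i, MonotoneOn τ (piece a i) ∨ AntitoneOn τ (piece a i)
  extend : ∀ i, ∃ T : ℝ → ℝ, EqOn T τ (piece a i) ∧
    ContDiffOn ℝ 1 T (Icc (a i.castSucc) (a i.succ))
  holder : ∀ i, ∃ M : ℝ, ∀ x ∈ piece a i, ∀ y ∈ piece a i,
    |deriv τ x - deriv τ y| ≤ M * |x - y| ^ ε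
  one_lt : ∀ i, 1 < s i
  slope : ∀ i, ∀ x ∈ piece a i, s i ≤ |deriv τ x|

/-- The Frobenius–Perron operator: `P_τ f (x)` is the sum, over the branches `i` whose image
`τ(I_i)` contains `x`, of `f y / |τ' y|`, where `y` is the point of `I_i` with `τ y = x`. -/
noncomputable def frobeniusPerron (τ : ℝ → ℝ) {q : ℕ} (a : Fin (q + 1) → ℝ) (f : ℝ → ℂ) :
    ℝ → ℂ := fun x =>
  ∑ i : Fin q, (τ '' piece a i).indicator
    (fun z => f (Function.invFunOn τ (piece a i) z) /
      ((|deriv τ (Function.invFunOn τ (piece a i) z)| : ℝ) : ℂ)) x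

/-! A branch of `P_τ f`, extended by zero off its image, is a function `h` with `h ∘ τ = f / |τ'|`.
A ball of radius `r` around `τ t` pulls back into a ball of radius `r / σ` around `t`, and the
Jacobian cancels `1 / |τ'|` up to a distortion `1 + η`, where the Hölder condition gives `η =
O(r^{1/p})`. So away from the ends of the image `∫ osc(h, r)` is at most about `∫ osc(f, r / σ)`,
which costs `σ^{-1/p} r^{1/p} var f`. The distortion also adds `η ‖f‖₁`.

Each end of the image adds the jump of `h` to zero. With `ρ = r / σ` and the end placed at `0`, this
amounts to `ρ · osc f` near the end plus `∫_0^{2ρ} |f|` (`lintegral_oscLine_half`). This end term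
must cost at most `σ⁻¹ r^{1/p} var f`, up to `‖f‖₁`. For `p > 1`, comparing `f` with its mean on
`(0, A)` costs `(3ρ / A) osc₁(f, A)`, which has a spare factor `(r / A)^{1-1/p}`. This absorbs the
`3` when `r / A` is small; otherwise `‖f‖₁` pays for the integral. For `p = 1` there is no spare
factor, and telescoping `f` in steps `2ρ` gives the sharp constant. `exists_endControl` merges these
cases.

Cutting each piece at its midpoint charges each end to its own half, so the constants are not
doubled when halves and branches are summed. Small `A` makes the distortion harmless. Large `A` is
handled by the equivalence of the variations for different `A`, and classes by passing to the
infimum over versions. -/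

/-! ### Bounds for the contribution of one end of a branch -/

/-- `W` dominates the oscillation of `F` at scale `ρ` inside `U`. -/
def DominatesOsc (U : Set ℝ) (ρ : ℝ) (F : ℝ → ℂ) (W : ℝ → ℝ≥0∞) : Prop :=
  ∀ t ∈ U, ∀ t₁ ∈ U, ∀ t₂ ∈ U, |t₁ - t| < ρ → |t₂ - t| < ρ → ‖F t₁ - F t₂‖ₑ ≤ W t

/-- The oscillation of `F` over a set. -/
noncomputable def oscOn (F : ℝ → ℂ) (U : Set ℝ) : ℝ≥0∞ :=
  ⨆ y₁ ∈ U, ⨆ y₂ ∈ U, ‖F y₁ - F y₂‖ₑ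

theorem le_oscOn {F : ℝ → ℂ} {U : Set ℝ} {y₁ y₂ : ℝ} (h₁ : y₁ ∈ U) (h₂ : y₂ ∈ U) :
    ‖F y₁ - F y₂‖ₑ ≤ oscOn F U := by
  unfold oscOn
  exact le_iSup₂_of_le y₁ h₁ (le_iSup₂_of_le y₂ h₂ le_rfl)

theorem oscOn_le {F : ℝ → ℂ} {U : Set ℝ} {C : ℝ≥0∞}
    (h : ∀ y₁ ∈ U, ∀ y₂ ∈ U, ‖F y₁ - F y₂‖ₑ ≤ C) : oscOn F U ≤ C := by
  unfold oscOn
  exact iSup₂_le fun y₁ h₁ => iSup₂_le fun y₂ h₂ => h y₁ h₁ y₂ h₂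

theorem oscOn_mono {F : ℝ → ℂ} {U V : Set ℝ} (h : U ⊆ V) : oscOn F U ≤ oscOn F V :=
  oscOn_le fun _ h₁ _ h₂ => le_oscOn (h h₁) (h h₂)

/-- The contribution of the end `0` of the interval `(0, 2L)` to the oscillation of a transferred
function is controlled by the oscillations of `F` at the scales `ρ'` and `A`. -/
def EndControl (L ρ ρ' A : ℝ) (θ₁ θ₂ B : ℝ≥0∞) : Prop :=
  ∀ (F : ℝ → ℂ) (W V : ℝ → ℝ≥0∞), Measurable W → Measurable V →
    DominatesOsc (Ioo 0 (2 * L)) ρ' F W → DominatesOsc (Ioo 0 (2 * L)) A F V →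
    ENNReal.ofReal ρ * oscOn F (Ioo 0 ρ') + ∫⁻ t in Ioo 0 (2 * ρ), ‖F t‖ₑ ≤
      θ₁ * (∫⁻ t in Ioo 0 L, W t) + θ₂ * (∫⁻ t in Ioo 0 L, V t) +
        B * ∫⁻ t in Ioo 0 L, ‖F t‖ₑ

/-- Since `x ≤ A`, every `t ∈ (0, x)` is within `A` of all of `(0, A)`, so `V t` already dominates
the full oscillation there. -/
theorem oscOn_mul_le_lintegral {L A x : ℝ} (hA : A ≤ L) (hxL : x ≤ A) {F : ℝ → ℂ}
    {V : ℝ → ℝ≥0∞} (hV : DominatesOsc (Ioo 0 (2 * L)) A F V) :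
    ENNReal.ofReal x * oscOn F (Ioo 0 A) ≤ ∫⁻ t in Ioo 0 x, V t := by
  have h : ∫⁻ _ in Ioo 0 x, oscOn F (Ioo 0 A) ≤ ∫⁻ t in Ioo 0 x, V t := by
    refine setLIntegral_mono' measurableSet_Ioo fun t ht => oscOn_le fun y₁ h₁ y₂ h₂ => ?_
    have := ht.1
    have := ht.2
    refine hV t ⟨ht.1, by linarith⟩ y₁ ⟨h₁.1, by linarith [h₁.2]⟩ y₂ ⟨h₂.1, by linarith [h₂.2]⟩
      ?_ ?_ <;> rw [abs_lt] <;> constructor <;> linarith [h₁.1, h₁.2, h₂.1, h₂.2]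
  rwa [setLIntegral_const, Real.volume_Ioo, sub_zero, mul_comm] at h

theorem enorm_mul_le_lintegral {F : ℝ → ℂ} {x y : ℝ} (hxy : x ≤ y) {t : ℝ}
    (ht : t ∈ Ioo 0 y) :
    ENNReal.ofReal x * ‖F t‖ₑ ≤ (∫⁻ t in Ioo 0 x, ‖F t‖ₑ) + ENNReal.ofReal x * oscOn F (Ioo 0 y) := by
  have h : ∫⁻ _ in Ioo 0 x, ‖F t‖ₑ ≤ ∫⁻ w in Ioo 0 x, (‖F w‖ₑ + oscOn F (Ioo 0 y)) := by
    refine setLIntegral_mono' measurableSet_Ioo fun w hw => ?_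
    calc ‖F t‖ₑ = ‖F w + (F t - F w)‖ₑ := by congr 1; ring
      _ ≤ _ := (enorm_add_le _ _).trans (by
        gcongr; exact le_oscOn ht ⟨hw.1, by linarith [hw.2]⟩)
  rw [lintegral_add_right _ measurable_const, setLIntegral_const, setLIntegral_const,
    Real.volume_Ioo, sub_zero] at h
  rwa [mul_comm, mul_comm (ENNReal.ofReal x)]

/-- Intended for `ρ` comparable to `A`: the coefficient `1` of the `L¹` term is affordable because
`r` is then bounded below. -/
theorem endControl_large {L ρ ρ' A : ℝ} (hρ' : ρ' ≤ A) (hA : 0 < A) (hAL : A ≤ L)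
    (hρ : 2 * ρ ≤ L) : EndControl L ρ ρ' A 0 (ENNReal.ofReal (ρ / A)) 1 := by
  intro F W V _ _ _ hV
  rw [zero_mul, zero_add, one_mul]
  refine add_le_add ?_ (lintegral_mono_set (Ioo_subset_Ioo_right hρ))
  have h1 := oscOn_mul_le_lintegral hAL le_rfl hV
  calc ENNReal.ofReal ρ * oscOn F (Ioo 0 ρ')
      ≤ ENNReal.ofReal (ρ / A * A) * oscOn F (Ioo 0 A) := by
        rw [div_mul_cancel₀ _ hA.ne']; gcongr; exact oscOn_mono (Ioo_subset_Ioo_right hρ')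
    _ = ENNReal.ofReal (ρ / A) * (ENNReal.ofReal A * oscOn F (Ioo 0 A)) := by
        rw [ENNReal.ofReal_mul' hA.le, mul_assoc]
    _ ≤ _ := by
        gcongr
        exact h1.trans (lintegral_mono_set (Ioo_subset_Ioo_right hAL))

/-- On `(0, A)` the value of `|F|` is at most its mean plus the oscillation. Integrating over `(0,
2ρ)` gives `2ρ / A` for both terms, and the oscillation term of the end adds `ρ / A`. -/
theorem endControl_small {L ρ ρ' A : ℝ} (h0 : 0 ≤ ρ) (hρ' : ρ' ≤ A) (hA : 0 < A) (hAL : A ≤ L)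
    (hρ : 2 * ρ ≤ A) :
    EndControl L ρ ρ' A 0 (ENNReal.ofReal (3 * ρ / A)) (ENNReal.ofReal (2 * ρ / A)) := by
  intro F W V _ _ _ hV
  rw [zero_mul, zero_add]
  set O := oscOn F (Ioo 0 A) with hO
  set N := ∫⁻ t in Ioo 0 L, ‖F t‖ₑ
  have h1 : ENNReal.ofReal A * O ≤ ∫⁻ t in Ioo 0 L, V t :=
    (oscOn_mul_le_lintegral hAL le_rfl hV).trans (lintegral_mono_set (Ioo_subset_Ioo_right hAL))
  have hd : ∀ x : ℝ, ENNReal.ofReal x = ENNReal.ofReal (x / A) * ENNReal.ofReal A := fun x => by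
    rw [← ENNReal.ofReal_mul' hA.le, div_mul_cancel₀ _ hA.ne']
  have h2 : ∫⁻ t in Ioo 0 (2 * ρ), ‖F t‖ₑ ≤
      ENNReal.ofReal (2 * ρ / A) * (N + ENNReal.ofReal A * O) := by
    have h3 : ∫⁻ t in Ioo 0 (2 * ρ), (ENNReal.ofReal A * ‖F t‖ₑ) ≤
        ∫⁻ t in Ioo 0 (2 * ρ), (N + ENNReal.ofReal A * O) := by
      refine setLIntegral_mono' measurableSet_Ioo fun t ht => ?_
      refine (enorm_mul_le_lintegral le_rfl ⟨ht.1, ht.2.trans_le hρ⟩).trans ?_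
      gcongr
      exact lintegral_mono_set (Ioo_subset_Ioo_right hAL)
    rw [lintegral_const_mul' _ _ ENNReal.ofReal_ne_top, setLIntegral_const, Real.volume_Ioo,
      sub_zero, hd (2 * ρ), ← mul_assoc, mul_comm] at h3
    have h4 := (ENNReal.mul_le_mul_iff_left (by simpa using hA) ENNReal.ofReal_ne_top).1 h3
    rwa [mul_comm (N + _)] at h4
  calc ENNReal.ofReal ρ * oscOn F (Ioo 0 ρ') + ∫⁻ t in Ioo 0 (2 * ρ), ‖F t‖ₑ
      ≤ ENNReal.ofReal (ρ / A) * ENNReal.ofReal A * O +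
        ENNReal.ofReal (2 * ρ / A) * (N + ENNReal.ofReal A * O) := by
        rw [← hd]; gcongr; exact oscOn_mono (Ioo_subset_Ioo_right hρ')
    _ = (ENNReal.ofReal (ρ / A) + ENNReal.ofReal (2 * ρ / A)) * (ENNReal.ofReal A * O) +
        ENNReal.ofReal (2 * ρ / A) * N := by ring
    _ ≤ _ := by
        rw [← ENNReal.ofReal_add (by positivity) (by positivity)]
        gcongr
        exact le_of_eq (by ring)

theorem setLIntegral_Ioo_shift (G : ℝ → ℝ≥0∞) (x y c : ℝ) :
    ∫⁻ t in Ioo x y, G (t + c) = ∫⁻ t in Ioo (x + c) (y + c), G t := by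
  have := (measurePreserving_add_right volume c).setLIntegral_comp_emb
    (measurableEmbedding_addRight c) G (Ioo x y)
  rw [this]; simp

theorem setLIntegral_Ioo_reflect (G : ℝ → ℝ≥0∞) (x y c : ℝ) :
    ∫⁻ t in Ioo x y, G (c - t) = ∫⁻ t in Ioo (c - y) (c - x), G t := by
  have := (Measure.measurePreserving_sub_left volume c).setLIntegral_comp_emb
    ((MeasurableEquiv.subLeft c).measurableEmbedding) G (Ioo x y)
  rw [this]; simp

theorem setLIntegral_Ioo_append (G : ℝ → ℝ≥0∞) {x y z : ℝ} (hxy : x ≤ y) (hyz : y ≤ z) :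
    (∫⁻ t in Ioo x y, G t) + ∫⁻ t in Ioo y z, G t = ∫⁻ t in Ioo x z, G t := by
  rw [setLIntegral_congr (Ioo_ae_eq_Ioc (a := x) (b := y)),
    setLIntegral_congr (Ioo_ae_eq_Ioc (a := y) (b := z)),
    setLIntegral_congr (Ioo_ae_eq_Ioc (a := x) (b := z)), ← Ioc_union_Ioc_eq_Ioc hxy hyz,
    lintegral_union measurableSet_Ioc]
  exact Set.disjoint_left.2 fun t h h' => absurd h.2 (not_le.2 h'.1)

/-- Telescoping `F` along an arithmetic progression with step `2ρ`. -/
theorem lintegral_chain {L ρ ρ' : ℝ} (h0 : 0 < ρ) (hρ : ρ < ρ') {F : ℝ → ℂ} {W : ℝ → ℝ≥0∞}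
    (hWm : Measurable W) (hW : DominatesOsc (Ioo 0 (2 * L)) ρ' F W) (n : ℕ)
    (hn : 2 * ρ * (n + 1) ≤ L) :
    ∫⁻ t in Ioo 0 (2 * ρ), ‖F t‖ₑ ≤
      (∫⁻ t in Ioo (2 * ρ * n) (2 * ρ * (n + 1)), ‖F t‖ₑ) +
        ∫⁻ t in Ioo ρ (ρ + 2 * ρ * n), W t := by
  induction n with
  | zero => simp
  | succ n ih =>
    push_cast at hn ⊢
    refine (ih (by nlinarith)).trans ?_
    -- `t` and `t + 2ρ` are compared from their midpoint `t + ρ`, which is within `ρ < ρ'` of both.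
    -- Over successive steps the midpoints sweep adjacent intervals, so `W` is integrated only once.
    have hstep : ∫⁻ t in Ioo (2 * ρ * n) (2 * ρ * (n + 1)), ‖F t‖ₑ ≤
        ∫⁻ t in Ioo (2 * ρ * n) (2 * ρ * (n + 1)), (‖F (t + 2 * ρ)‖ₑ + W (t + ρ)) := by
      refine setLIntegral_mono' measurableSet_Ioo fun t ht => ?_
      have hn0 : 0 ≤ 2 * ρ * n := by positivity
      have h1 := ht.1
      have h2 := ht.2
      calc ‖F t‖ₑ = ‖F (t + 2 * ρ) + (F t - F (t + 2 * ρ))‖ₑ := by congr 1; ring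
        _ ≤ _ := (enorm_add_le _ _).trans (by
          gcongr
          refine hW _ ⟨by linarith, by nlinarith⟩ _ ⟨by linarith, by nlinarith⟩ _
            ⟨by linarith, by nlinarith⟩ ?_ ?_ <;> rw [abs_lt] <;> constructor <;> linarith)
    rw [lintegral_add_right _ (by fun_prop), setLIntegral_Ioo_shift (fun t => ‖F t‖ₑ),
      setLIntegral_Ioo_shift W] at hstep
    have e1 : (2 * ρ * n + 2 * ρ) = 2 * ρ * (n + 1) := by ring
    have e2 : (2 * ρ * (n + 1) + 2 * ρ) = 2 * ρ * (n + 1 + 1) := by ring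
    have e3 : (2 * ρ * n + ρ) = ρ + 2 * ρ * n := by ring
    have e4 : (2 * ρ * (n + 1) + ρ) = ρ + 2 * ρ * (n + 1) := by ring
    rw [e1, e2, e3, e4] at hstep
    refine (add_le_add_left hstep _).trans ?_
    have hn0 : 0 ≤ 2 * ρ * n := by positivity
    rw [add_assoc, add_comm (∫⁻ t in Ioo (ρ + 2 * ρ * n) (ρ + 2 * ρ * (n + 1)), W t),
      setLIntegral_Ioo_append W (by linarith) (by nlinarith)]

theorem sum_setLIntegral_Ioo (G : ℝ → ℝ≥0∞) {d : ℝ} (hd : 0 ≤ d) (N : ℕ) :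
    ∑ n ∈ Finset.range N, ∫⁻ t in Ioo (d * n) (d * (n + 1)), G t =
      ∫⁻ t in Ioo 0 (d * N), G t := by
  induction N with
  | zero => simp
  | succ N ih =>
    rw [Finset.sum_range_succ, ih, setLIntegral_Ioo_append G (by positivity) (by nlinarith)]
    push_cast; rfl

/-- The coefficient of `∫ W` is exactly `1`: the oscillation near `0` uses `W` only on `(0, ρ)`, and
the telescoping uses it only on `(ρ, L)`. -/
theorem endControl_chain {L ℓ ρ ρ' A : ℝ} (h0 : 0 < ρ) (hρ : ρ < ρ') (hρL : ρ' ≤ L)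
    (hℓ : 0 < ℓ) (hℓL : ℓ ≤ L) (h2 : 2 * ρ ≤ ℓ) :
    EndControl L ρ ρ' A 1 0 (ENNReal.ofReal (4 * ρ / ℓ)) := by
  intro F W V hWm _ hW _
  rw [zero_mul, add_zero, one_mul]
  -- The number of steps `2ρ` that fit in `(0, L)`. As `N ≥ 1`, rounding down loses at most a factor
  -- `2`, whence the `4ρ / ℓ`.
  obtain ⟨N, hN⟩ : ∃ N : ℕ, N = ⌊L / (2 * ρ)⌋₊ := ⟨_, rfl⟩
  have hN1 : 1 ≤ N := by
    rw [hN, Nat.one_le_floor_iff, le_div_iff₀ (by positivity)]; linarith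
  have hN1' : (1 : ℝ) ≤ N := by exact_mod_cast hN1
  have hNle : 2 * ρ * N ≤ L := by
    have := Nat.floor_le (a := L / (2 * ρ)) (by have : 0 < L := by linarith
                                                positivity)
    rw [← hN, le_div_iff₀ (by positivity)] at this; linarith
  have hNge : L ≤ 4 * ρ * N := by
    have := Nat.lt_floor_add_one (L / (2 * ρ))
    rw [← hN, div_lt_iff₀ (by positivity)] at this; nlinarith
  have hosc := oscOn_mul_le_lintegral hρL hρ.le hW
  -- Averaging the chains of lengths `0, …, N - 1`: their last links tile `(0, 2ρN)`, so `‖F‖`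
  -- enters with weight `1 / N`.
  have hsum : ∑ n ∈ Finset.range N, ∫⁻ t in Ioo 0 (2 * ρ), ‖F t‖ₑ ≤
      ∑ n ∈ Finset.range N, ((∫⁻ t in Ioo (2 * ρ * n) (2 * ρ * (n + 1)), ‖F t‖ₑ) +
        ∫⁻ t in Ioo ρ L, W t) := by
    refine Finset.sum_le_sum fun n hn => ?_
    have : (n : ℝ) + 1 ≤ N := by exact_mod_cast Finset.mem_range.1 hn
    have h3 : 2 * ρ * (n + 1) ≤ L := (by gcongr : 2 * ρ * ((n : ℝ) + 1) ≤ 2 * ρ * N).trans hNle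
    refine (lintegral_chain h0 hρ hWm hW n h3).trans ?_
    gcongr
    nlinarith
  rw [Finset.sum_add_distrib, sum_setLIntegral_Ioo (fun t => ‖F t‖ₑ) (by positivity)] at hsum
  simp only [Finset.sum_const, Finset.card_range, nsmul_eq_mul] at hsum
  have hF : ∫⁻ t in Ioo 0 (2 * ρ), ‖F t‖ₑ ≤
      ENNReal.ofReal (4 * ρ / ℓ) * (∫⁻ t in Ioo 0 L, ‖F t‖ₑ) + ∫⁻ t in Ioo ρ L, W t := by
    have hN0 : (N : ℝ≥0∞) ≠ 0 := by
      have : N ≠ 0 := by omega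
      exact_mod_cast this
    refine (ENNReal.mul_le_mul_iff_right hN0 (ENNReal.natCast_ne_top N)).1 (hsum.trans ?_)
    rw [mul_add, ← mul_assoc]
    gcongr
    refine (lintegral_mono_set (Ioo_subset_Ioo_right hNle)).trans ?_
    refine le_mul_of_one_le_left' ?_
    rw [← ENNReal.ofReal_natCast, ← ENNReal.ofReal_mul (by positivity), ENNReal.one_le_ofReal,
      ← mul_div_assoc, le_div_iff₀ hℓ]
    nlinarith
  calc _ ≤ (∫⁻ t in Ioo 0 ρ, W t) + (ENNReal.ofReal (4 * ρ / ℓ) * (∫⁻ t in Ioo 0 L, ‖F t‖ₑ) +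
        ∫⁻ t in Ioo ρ L, W t) := add_le_add hosc hF
    _ = _ := by
      rw [add_comm (ENNReal.ofReal (4 * ρ / ℓ) * _), ← add_assoc,
        setLIntegral_Ioo_append W h0.le (by linarith)]

/-! ### Oscillation of the transferred function on half a branch -/

/-- The oscillation over the full ball `(x - r, x + r)` of the line. -/
noncomputable def oscLine (h : ℝ → ℂ) (r x : ℝ) : ℝ≥0∞ := oscOn h (Ioo (x - r) (x + r))

theorem mul_oscOn_le {F : ℝ → ℂ} {U : Set ℝ} {a C : ℝ≥0∞}
    (h : ∀ y₁ ∈ U, ∀ y₂ ∈ U, a * ‖F y₁ - F y₂‖ₑ ≤ C) : a * oscOn F U ≤ C := by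
  unfold oscOn
  simp only [ENNReal.mul_iSup]
  exact iSup₂_le fun y₁ h₁ => iSup₂_le fun y₂ h₂ => h y₁ h₁ y₂ h₂

/-- The jump across `c` is measured at one reference point `z`, by writing `h y = (h y - h z) + h
z`. -/
theorem mul_oscOn_le_of_eq_zero {h : ℝ → ℂ} {U : Set ℝ} {a C : ℝ≥0∞} {c z : ℝ}
    (h₁ : ∀ y₁ ∈ U, ∀ y₂ ∈ U, c < y₁ → c < y₂ → a * ‖h y₁ - h y₂‖ₑ ≤ C)
    (h₂ : ∀ y ∈ U, c < y → a * ‖h y - h z‖ₑ ≤ C) (h₀ : ∀ y ≤ c, h y = 0) :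
    a * oscOn h U ≤ C + a * ‖h z‖ₑ := by
  have key : ∀ y ∈ U, c < y → a * ‖h y‖ₑ ≤ C + a * ‖h z‖ₑ := fun y hy hc => by
    calc a * ‖h y‖ₑ = a * ‖(h y - h z) + h z‖ₑ := by rw [sub_add_cancel]
      _ ≤ a * (‖h y - h z‖ₑ + ‖h z‖ₑ) := by gcongr; exact enorm_add_le _ _
      _ ≤ _ := by rw [mul_add]; gcongr; exact h₂ y hy hc
  refine mul_oscOn_le fun y₁ hy₁ y₂ hy₂ => ?_
  rcases le_or_gt y₁ c with h1 | h1 <;> rcases le_or_gt y₂ c with h2 | h2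
  · simp [h₀ _ h1, h₀ _ h2]
  · rw [h₀ _ h1, zero_sub, enorm_neg]; exact key _ hy₂ h2
  · rw [h₀ _ h2, sub_zero]; exact key _ hy₁ h1
  · exact (h₁ _ hy₁ _ hy₂ h1 h2).trans le_self_add

theorem enorm_div_sub_div_le {z₁ z₂ : ℂ} {s d₁ d₂ η : ℝ} (hs : 1 ≤ s) (h₁ : s ≤ d₁) (h₂ : s ≤ d₂)
    (hd : |d₁ - d₂| ≤ η) :
    ‖z₁ / (d₁ : ℂ) - z₂ / (d₂ : ℂ)‖ₑ ≤
      ENNReal.ofReal (1 / d₁) * (‖z₁ - z₂‖ₑ + ENNReal.ofReal η * ‖z₂‖ₑ) := by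
  have p1 : 0 < d₁ := by linarith
  have p2 : 0 < d₂ := by linarith
  have hη : 0 ≤ η := (abs_nonneg _).trans hd
  have c1 : (d₁ : ℂ) ≠ 0 := by exact_mod_cast p1.ne'
  have c2 : (d₂ : ℂ) ≠ 0 := by exact_mod_cast p2.ne'
  have e : z₁ / (d₁ : ℂ) - z₂ / (d₂ : ℂ) =
      ((1 / d₁ : ℝ) : ℂ) * ((z₁ - z₂) + (((d₂ - d₁) / d₂ : ℝ) : ℂ) * z₂) := by
    push_cast; field_simp; ring
  have n1 : ‖z₁ / (d₁ : ℂ) - z₂ / (d₂ : ℂ)‖ ≤ 1 / d₁ * (‖z₁ - z₂‖ + η * ‖z₂‖) := by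
    rw [e, norm_mul, Complex.norm_real, Real.norm_of_nonneg (by positivity)]
    gcongr
    refine (norm_add_le _ _).trans ?_
    rw [norm_mul, Complex.norm_real, Real.norm_eq_abs, abs_div, abs_of_pos p2, abs_sub_comm]
    gcongr
    exact (div_le_self (abs_nonneg _) (by linarith)).trans hd
  rw [← ofReal_norm, ← ofReal_norm, ← ofReal_norm,
    ← ENNReal.ofReal_mul hη, ← ENNReal.ofReal_add (by positivity) (by positivity),
    ← ENNReal.ofReal_mul (by positivity)]
  exact ENNReal.ofReal_le_ofReal n1

theorem expanding_of_slope {ℓ s : ℝ} {T Tp : ℝ → ℝ} (hT : ∀ t ∈ Ioo 0 ℓ, HasDerivAt T (Tp t) t)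
    (hslope : ∀ t ∈ Ioo 0 ℓ, s ≤ Tp t) {t₁ t₂ : ℝ} (h₁ : t₁ ∈ Ioo 0 ℓ) (h₂ : t₂ ∈ Ioo 0 ℓ)
    (h : t₁ ≤ t₂) : s * (t₂ - t₁) ≤ T t₂ - T t₁ := by
  refine (convex_Ioo 0 ℓ).mul_sub_le_image_sub_of_le_deriv
    (fun t ht => (hT t ht).continuousAt.continuousWithinAt)
    (fun t ht => (hT t (interior_subset ht)).differentiableAt.differentiableWithinAt)
    (fun t ht => ?_) _ h₁ _ h₂ h
  rw [(hT t (interior_subset ht)).deriv]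
  exact hslope t (interior_subset ht)

theorem mul_abs_sub_le_of_slope {ℓ s : ℝ} {T Tp : ℝ → ℝ}
    (hT : ∀ t ∈ Ioo 0 ℓ, HasDerivAt T (Tp t) t)
    (hslope : ∀ t ∈ Ioo 0 ℓ, s ≤ Tp t) {t₁ t₂ : ℝ} (h₁ : t₁ ∈ Ioo 0 ℓ) (h₂ : t₂ ∈ Ioo 0 ℓ) :
    s * |t₁ - t₂| ≤ |T t₁ - T t₂| := by
  rcases le_total t₁ t₂ with h | h
  · rw [abs_sub_comm, abs_of_nonneg (sub_nonneg.2 h), abs_sub_comm]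
    exact (expanding_of_slope hT hslope h₁ h₂ h).trans (le_abs_self _)
  · rw [abs_of_nonneg (sub_nonneg.2 h)]
    exact (expanding_of_slope hT hslope h₂ h₁ h).trans (le_abs_self _)

/-- `c` is the infimum of the image, that is, the limit of `T` at `0`; no value of `T` at `0` is
needed. -/
theorem exists_left_end {ℓ s : ℝ} {T Tp : ℝ → ℝ} (hs : 0 < s)
    (hT : ∀ t ∈ Ioo 0 ℓ, HasDerivAt T (Tp t) t)
    (hslope : ∀ t ∈ Ioo 0 ℓ, s ≤ Tp t) (hb : BddBelow (T '' Ioo 0 ℓ)) :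
    ∃ c, (∀ t ∈ Ioo 0 ℓ, c + s * t ≤ T t) ∧
      ∀ t ∈ Ioo 0 ℓ, ∀ x ∈ Ioo c (T t), ∃ t' ∈ Ioo 0 t, T t' = x := by
  refine ⟨sInf (T '' Ioo 0 ℓ), fun t ht => ?_, fun t ht x hx => ?_⟩
  · refine le_of_forall_pos_le_add fun e he => ?_
    have hm : min t (e / s) ≤ t := min_le_left _ _
    have hm0 : 0 < min t (e / s) := lt_min ht.1 (by positivity)
    have hm2 : s * min t (e / s) ≤ e := by
      have := mul_le_mul_of_nonneg_left (min_le_right t (e / s)) hs.le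
      rwa [mul_div_cancel₀ _ hs.ne'] at this
    have hmem : min t (e / s) ∈ Ioo 0 ℓ := ⟨hm0, hm.trans_lt ht.2⟩
    have h1 := csInf_le hb (mem_image_of_mem T hmem)
    have h2 := expanding_of_slope hT hslope hmem ht hm
    nlinarith
  · obtain ⟨_, ⟨t₀, ht₀, rfl⟩, hlt⟩ := exists_lt_of_csInf_lt ⟨T t, mem_image_of_mem T ht⟩ hx.1
    have h0 : t₀ < t := by
      by_contra! hle
      have h1 := expanding_of_slope hT hslope ht ht₀ hle
      have h2 : 0 ≤ s * (t₀ - t) := mul_nonneg hs.le (sub_nonneg.2 hle)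
      linarith [hx.2]
    have hc : ContinuousOn T (Icc t₀ t) := fun w hw =>
      (hT w ⟨ht₀.1.trans_le hw.1, hw.2.trans_lt ht.2⟩).continuousAt.continuousWithinAt
    obtain ⟨t', ht', rfl⟩ := intermediate_value_Icc h0.le hc ⟨hlt.le, hx.2.le⟩
    refine ⟨t', ⟨ht₀.1.trans_le ht'.1, lt_of_le_of_ne ht'.2 ?_⟩, rfl⟩
    rintro rfl
    exact lt_irrefl _ hx.2

/-- The oscillation of the transferred function `h = (F / T') ∘ T⁻¹`, integrated over the half-line
up to the image of the midpoint: an interior term plus the contribution of the end `0`. -/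
theorem lintegral_oscLine_half {L s r ρ' η : ℝ} (hL : 0 < L) (hs : 1 < s) (hr : 0 < r)
    (hrL : r ≤ L) (hρ' : r / s < ρ') (hρL : ρ' ≤ L) {T Tp : ℝ → ℝ}
    (hT : ∀ t ∈ Ioo 0 (2 * L), HasDerivAt T (Tp t) t)
    (hslope : ∀ t ∈ Ioo 0 (2 * L), s ≤ Tp t) (hb : BddBelow (T '' Ioo 0 (2 * L)))
    (hη : ∀ t₁ ∈ Ioo 0 (2 * L), ∀ t₂ ∈ Ioo 0 (2 * L), |t₁ - t₂| < 2 * ρ' → |Tp t₁ - Tp t₂| ≤ η)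
    {F h : ℝ → ℂ} (hFm : AEMeasurable F (volume.restrict (Ioo 0 L)))
    (hh : ∀ t ∈ Ioo 0 (2 * L), h (T t) = F t / (Tp t : ℂ))
    (hh₀ : ∀ x, x ∉ T '' Ioo 0 (2 * L) → h x = 0) {W : ℝ → ℝ≥0∞} (hWm : Measurable W)
    (hW : DominatesOsc (Ioo 0 (2 * L)) ρ' F W) :
    ∫⁻ x in Iio (T L), oscLine h r x ≤ (1 + ENNReal.ofReal η) ^ 2 *
      ((∫⁻ t in Ioo 0 L, W t) + ENNReal.ofReal η * (∫⁻ t in Ioo 0 L, ‖F t‖ₑ) +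
        (ENNReal.ofReal (r / s) * oscOn F (Ioo 0 ρ') +
          ∫⁻ t in Ioo 0 (2 * (r / s)), ‖F t‖ₑ)) := by
  have hs0 : 0 < s := by linarith
  set ρ := r / s with hρdef
  have hρ0 : 0 < ρ := by positivity
  have hsρ : s * ρ = r := by rw [hρdef]; field_simp
  obtain ⟨c, hc1, hc2⟩ := exists_left_end hs0 hT hslope hb
  have hη0 : 0 ≤ η := by
    have := hη L ⟨hL, by linarith⟩ L ⟨hL, by linarith⟩ (by simp; linarith)
    exact (abs_nonneg _).trans this
  set H := ENNReal.ofReal η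
  set O := oscOn F (Ioo 0 ρ')
  have hTp : ∀ t ∈ Ioo 0 (2 * L), 0 < Tp t := fun t ht => by linarith [hslope t ht]
  have hcz : ∀ y ≤ c, h y = 0 := fun y hy => hh₀ y (by
    rintro ⟨t, ht, rfl⟩
    have := hc1 t ht
    have : 0 < s * t := mul_pos hs0 ht.1
    linarith)
  have hinj : InjOn T (Ioo 0 (2 * L)) := fun t₁ h₁ t₂ h₂ he => by
    have := mul_abs_sub_le_of_slope hT hslope h₁ h₂
    rw [he, sub_self, abs_zero] at this
    have h3 : |t₁ - t₂| ≤ 0 := by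
      by_contra! h4
      nlinarith
    linarith [abs_nonpos_iff.1 h3]
  -- oscillation of `h` at an image point
  set Γ : ℝ → ℝ≥0∞ := fun t => (1 + H) ^ 2 * (W t + H * ‖F t‖ₑ)
  have hΓ : ∀ t ∈ Ioo 0 (2 * L), ∀ t₁ ∈ Ioo 0 (2 * L), ∀ t₂ ∈ Ioo 0 (2 * L), |t₁ - t| < ρ' →
      |t₂ - t| < ρ' → ENNReal.ofReal (Tp t) * ‖h (T t₁) - h (T t₂)‖ₑ ≤ Γ t := by
    intro t ht t₁ ht₁ t₂ ht₂ d₁ d₂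
    have d12 : |t₁ - t₂| < 2 * ρ' := by
      rw [abs_lt] at *; constructor <;> linarith
    have dt1 : |t - t₁| < 2 * ρ' := by
      rw [abs_lt] at *; constructor <;> linarith
    have hF2 : ‖F t₂‖ₑ ≤ ‖F t‖ₑ + W t := by
      calc ‖F t₂‖ₑ = ‖F t + (F t₂ - F t)‖ₑ := by congr 1; ring
        _ ≤ _ := (enorm_add_le _ _).trans (by
          gcongr; exact hW t ht t₂ ht₂ t ht d₂ (by simp; linarith))
    -- `Tp t ≤ Tp t₁ + η ≤ (1 + η) Tp t₁`, because `Tp t₁ ≥ 1`.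
    have hq : ENNReal.ofReal (Tp t) * ENNReal.ofReal (1 / Tp t₁) ≤ 1 + H := by
      rw [← ENNReal.ofReal_mul (hTp t ht).le, ← ENNReal.ofReal_one,
        ← ENNReal.ofReal_add zero_le_one hη0]
      refine ENNReal.ofReal_le_ofReal ?_
      rw [mul_one_div, div_le_iff₀ (hTp t₁ ht₁)]
      have h1 := (abs_le.1 (hη t ht t₁ ht₁ dt1)).2
      have h2 := hslope t₁ ht₁
      nlinarith
    rw [hh t₁ ht₁, hh t₂ ht₂]
    calc _ ≤ ENNReal.ofReal (Tp t) * (ENNReal.ofReal (1 / Tp t₁) *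
          (‖F t₁ - F t₂‖ₑ + H * ‖F t₂‖ₑ)) := by
          gcongr
          exact enorm_div_sub_div_le hs.le (hslope t₁ ht₁) (hslope t₂ ht₂) (hη t₁ ht₁ t₂ ht₂ d12)
      _ ≤ (1 + H) * (W t + H * (‖F t‖ₑ + W t)) := by
          rw [← mul_assoc]
          gcongr
          exact hW t ht t₁ ht₁ t₂ ht₂ d₁ d₂
      -- The added term completes the expression to the product `(1 + H)² (W + H ‖F‖)`.
      _ ≤ (1 + H) * (W t + H * (‖F t‖ₑ + W t)) + (1 + H) * H * H * ‖F t‖ₑ := le_self_add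
      _ = _ := by simp only [Γ]; ring
  -- oscillation of `h` next to the end of the image
  set D : ℝ≥0∞ := ENNReal.ofReal (1 / s) * (O + H * (O + ENNReal.ofReal (1 / ρ) *
    ∫⁻ t in Ioo 0 ρ, ‖F t‖ₑ))
  have hD : ∀ t₁ ∈ Ioo 0 ρ', ∀ t₂ ∈ Ioo 0 ρ', ‖h (T t₁) - h (T t₂)‖ₑ ≤ D := by
    intro t₁ ht₁ t₂ ht₂
    have m₁ : t₁ ∈ Ioo 0 (2 * L) := ⟨ht₁.1, by linarith [ht₁.2]⟩
    have m₂ : t₂ ∈ Ioo 0 (2 * L) := ⟨ht₂.1, by linarith [ht₂.2]⟩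
    have d12 : |t₁ - t₂| < 2 * ρ' := by
      rw [abs_lt]; constructor <;> linarith [ht₁.1, ht₁.2, ht₂.1, ht₂.2]
    rw [hh t₁ m₁, hh t₂ m₂]
    refine (enorm_div_sub_div_le hs.le (hslope t₁ m₁) (hslope t₂ m₂)
      (hη t₁ m₁ t₂ m₂ d12)).trans ?_
    -- Left of `c` there is no base point `t` to compare with, so the mean of `‖F‖` on `(0, ρ)`
    -- replaces `‖F t‖`.
    have hF2 : ‖F t₂‖ₑ ≤ O + ENNReal.ofReal (1 / ρ) * ∫⁻ t in Ioo 0 ρ, ‖F t‖ₑ := by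
      have h1 := mul_le_mul_right (enorm_mul_le_lintegral (F := F) hρ'.le ht₂) (ENNReal.ofReal (1 / ρ))
      rw [mul_add, ← mul_assoc, ← mul_assoc, ← ENNReal.ofReal_mul (by positivity),
        one_div_mul_cancel hρ0.ne', ENNReal.ofReal_one, one_mul, one_mul, add_comm] at h1
      exact h1
    simp only [D]
    gcongr
    · exact hslope t₁ m₁
    · exact le_oscOn ht₁ ht₂
  have hrD : D * ENNReal.ofReal r ≤ (1 + H) * (ENNReal.ofReal ρ * O) +
      H * ∫⁻ t in Ioo 0 ρ, ‖F t‖ₑ := by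
    have e1 : ENNReal.ofReal (1 / s) * ENNReal.ofReal r = ENNReal.ofReal ρ := by
      rw [← ENNReal.ofReal_mul (by positivity), hρdef]; congr 1; ring
    have e2 : ENNReal.ofReal ρ * ENNReal.ofReal (1 / ρ) = 1 := by
      rw [← ENNReal.ofReal_mul hρ0.le, mul_one_div_cancel hρ0.ne', ENNReal.ofReal_one]
    set N := ∫⁻ t in Ioo 0 ρ, ‖F t‖ₑ
    calc D * ENNReal.ofReal r
        = (ENNReal.ofReal (1 / s) * ENNReal.ofReal r) * (O + H * O) +
          H * ((ENNReal.ofReal (1 / s) * ENNReal.ofReal r) * ENNReal.ofReal (1 / ρ)) * N := by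
          simp only [D]; ring
      _ = (1 + H) * (ENNReal.ofReal ρ * O) + H * N := by rw [e1, e2]; ring
      _ ≤ _ := le_rfl
  -- The price of the jump at `c`, measured at the right end `x + r` of the ball, which lies beyond
  -- `c`. Its integral is that of `‖h‖` over `(c, c + 2r)`, whose preimage lies in `(0, 2ρ)`.
  set k : ℝ → ℝ≥0∞ := (Ioo (c - r) (c + r)).indicator fun x => ‖h (x + r)‖ₑ with hk
  -- The second half of the interval gives room on the right: `T (t + L) ≥ T t + s L > T t + r`, so
  -- only the end `c` can interfere.
  have hpre : ∀ t ∈ Ioo 0 L, ∀ y, c < y → |y - T t| ≤ r →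
      ∃ t₁ ∈ Ioo 0 (2 * L), |t₁ - t| < ρ' ∧ T t₁ = y := by
    intro t ht y hy hd
    have mt : t ∈ Ioo 0 (2 * L) := ⟨ht.1, by linarith [ht.2]⟩
    have mt' : t + L ∈ Ioo 0 (2 * L) := ⟨by linarith [ht.1], by linarith [ht.2]⟩
    have h1 := expanding_of_slope hT hslope mt mt' (by linarith)
    have h2 := (abs_le.1 hd).2
    obtain ⟨t₁, ht₁, rfl⟩ := hc2 (t + L) mt' y ⟨hy, by nlinarith⟩
    have m₁ : t₁ ∈ Ioo 0 (2 * L) := ⟨ht₁.1, ht₁.2.trans mt'.2⟩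
    refine ⟨t₁, m₁, lt_of_le_of_lt ?_ hρ', rfl⟩
    rw [hρdef, le_div_iff₀ hs0, mul_comm]
    exact (mul_abs_sub_le_of_slope hT hslope m₁ mt).trans hd
  have hC1 : ∀ t ∈ Ioo 0 L, ENNReal.ofReal (Tp t) * oscLine h r (T t) ≤
      Γ t + ENNReal.ofReal (Tp t) * k (T t) := by
    intro t ht
    have mt : t ∈ Ioo 0 (2 * L) := ⟨ht.1, by linarith [ht.2]⟩
    have hball : ∀ y ∈ Ioo (T t - r) (T t + r), |y - T t| ≤ r := fun y hy => by
      rw [abs_le]; constructor <;> linarith [hy.1, hy.2]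
    have hct : c < T t := by have := hc1 t mt; have := mul_pos hs0 ht.1; linarith
    have hboth : ∀ y₁ y₂, c < y₁ → c < y₂ → |y₁ - T t| ≤ r → |y₂ - T t| ≤ r →
        ENNReal.ofReal (Tp t) * ‖h y₁ - h y₂‖ₑ ≤ Γ t := by
      intro y₁ y₂ c₁ c₂ d₁ d₂
      obtain ⟨t₁, m₁, e₁, rfl⟩ := hpre t ht y₁ c₁ d₁
      obtain ⟨t₂, m₂, e₂, rfl⟩ := hpre t ht y₂ c₂ d₂
      exact hΓ t mt t₁ m₁ t₂ m₂ e₁ e₂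
    rcases le_or_gt (c + r) (T t) with hfar | hnear
    · refine le_trans (mul_oscOn_le fun y₁ h₁ y₂ h₂ => ?_) le_self_add
      exact hboth _ _ (by linarith [h₁.1]) (by linarith [h₂.1]) (hball _ h₁) (hball _ h₂)
    · have hkt : k (T t) = ‖h (T t + r)‖ₑ := by
        rw [hk, indicator_of_mem]; exact ⟨by linarith, hnear⟩
      rw [hkt]
      refine mul_oscOn_le_of_eq_zero
        (fun y₁ h₁ y₂ h₂ c₁ c₂ => hboth _ _ c₁ c₂ (hball _ h₁) (hball _ h₂))
        (fun y hy cy => hboth _ _ cy (by linarith) (hball _ hy) ?_) hcz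
      simp [abs_of_pos hr]
  have hC2 : ∀ x ∈ Ioc (c - r) c, oscLine h r x ≤ D + k x := by
    intro x hx
    have hkt : k x = ‖h (x + r)‖ₑ := by
      rw [hk, indicator_of_mem]; exact ⟨hx.1, by linarith [hx.2]⟩
    have mρ : ρ' ∈ Ioo 0 (2 * L) := ⟨by linarith, by linarith⟩
    have hcr : ∀ y, c < y → y ≤ x + r → ∃ t ∈ Ioo 0 ρ', T t = y := fun y h1 h2 => by
      refine hc2 ρ' mρ y ⟨h1, ?_⟩
      have := hc1 ρ' mρ
      have : s * ρ < s * ρ' := by gcongr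
      linarith [hx.2]
    have hboth : ∀ y₁ y₂, c < y₁ → c < y₂ → y₁ ≤ x + r → y₂ ≤ x + r →
        ‖h y₁ - h y₂‖ₑ ≤ D := by
      intro y₁ y₂ c₁ c₂ d₁ d₂
      obtain ⟨t₁, m₁, rfl⟩ := hcr y₁ c₁ d₁
      obtain ⟨t₂, m₂, rfl⟩ := hcr y₂ c₂ d₂
      exact hD t₁ m₁ t₂ m₂
    have := mul_oscOn_le_of_eq_zero (a := 1) (C := D) (U := Ioo (x - r) (x + r)) (z := x + r)
      (fun y₁ h₁ y₂ h₂ c₁ c₂ => by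
        rw [one_mul]; exact hboth _ _ c₁ c₂ h₁.2.le h₂.2.le)
      (fun y hy cy => by
        rw [one_mul]; exact hboth _ _ cy (by linarith [hx.1]) hy.2.le le_rfl) hcz
    rw [one_mul, one_mul] at this
    rw [hkt]
    exact this
  have hC3 : ∀ x ∈ Iic (c - r), oscLine h r x = 0 := by
    intro x hx
    have hx' : x ≤ c - r := hx
    refine le_antisymm (oscOn_le fun y₁ h₁ y₂ h₂ => ?_) zero_le
    rw [hcz _ (by linarith [h₁.2]), hcz _ (by linarith [h₂.2])]; simp
  -- integration
  have hsub : Ioo 0 L ⊆ Ioo 0 (2 * L) := Ioo_subset_Ioo_right (by linarith)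
  have hcov : ∀ l, 0 ≤ l → l ≤ L → ∀ g : ℝ → ℝ≥0∞,
      ∫⁻ x in T '' Ioo 0 (2 * l), g x = ∫⁻ t in Ioo 0 (2 * l), ENNReal.ofReal (Tp t) * g (T t) := by
    intro l hl hlL g
    have hsub : Ioo 0 (2 * l) ⊆ Ioo 0 (2 * L) := Ioo_subset_Ioo_right (by linarith)
    rw [lintegral_image_eq_lintegral_abs_deriv_mul measurableSet_Ioo
      (fun t ht => (hT t (hsub ht)).hasDerivWithinAt) (hinj.mono hsub)]
    refine setLIntegral_congr_fun measurableSet_Ioo fun t ht => ?_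
    rw [abs_of_pos (hTp t (hsub ht))]
  have hcovL : ∀ g : ℝ → ℝ≥0∞,
      ∫⁻ x in T '' Ioo 0 L, g x = ∫⁻ t in Ioo 0 L, ENNReal.ofReal (Tp t) * g (T t) := by
    intro g
    have := hcov (L / 2) (by linarith) (by linarith) g
    rwa [mul_div_cancel₀ _ two_ne_zero] at this
  have hkint : ∫⁻ x, k x ≤ ∫⁻ t in Ioo 0 (2 * ρ), ‖F t‖ₑ := by
    have hρL' : ρ ≤ L := by linarith
    rw [hk, lintegral_indicator measurableSet_Ioo, setLIntegral_Ioo_shift (fun x => ‖h x‖ₑ),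
      sub_add_cancel]
    have hsubim : Ioo c (c + r + r) ⊆ T '' Ioo 0 (2 * ρ) := fun x hx => by
      have m : 2 * ρ ∈ Ioo 0 (2 * L) := ⟨by linarith, by linarith⟩
      have := hc1 (2 * ρ) m
      obtain ⟨t, ht, rfl⟩ := hc2 (2 * ρ) m x ⟨hx.1, by linarith [hx.2]⟩
      exact mem_image_of_mem T ht
    refine (lintegral_mono_set hsubim).trans ?_
    rw [hcov ρ hρ0.le hρL']
    refine setLIntegral_mono' measurableSet_Ioo fun t ht => ?_
    have mt : t ∈ Ioo 0 (2 * L) := ⟨ht.1, by linarith [ht.2]⟩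
    have hp := hTp t mt
    rw [hh t mt, div_eq_mul_inv, enorm_mul, mul_comm ‖F t‖ₑ, ← mul_assoc]
    refine mul_le_of_le_one_left' (le_of_eq ?_)
    rw [← Complex.ofReal_inv, ← ofReal_norm, Complex.norm_real,
      Real.norm_of_nonneg (by positivity), ← ENNReal.ofReal_mul hp.le, mul_inv_cancel₀ hp.ne',
      ENNReal.ofReal_one]
  have hΓint : ∫⁻ t in Ioo 0 L, Γ t =
      (1 + H) ^ 2 * ((∫⁻ t in Ioo 0 L, W t) + H * ∫⁻ t in Ioo 0 L, ‖F t‖ₑ) := by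
    simp only [Γ]
    rw [lintegral_const_mul' _ _ (by finiteness), lintegral_add_left hWm,
      lintegral_const_mul' _ _ (by finiteness)]
  -- `h` is not assumed measurable, so sums of integrals are split using the measurability of `Γ`
  -- alone.
  have hΓm : AEMeasurable Γ (volume.restrict (Ioo 0 L)) :=
    ((hWm.aemeasurable.add (hFm.enorm.const_mul H)).const_mul _)
  have hI1 : ∫⁻ x in T '' Ioo 0 L, oscLine h r x ≤
      (∫⁻ t in Ioo 0 L, Γ t) + ∫⁻ x in T '' Ioo 0 L, k x := by
    rw [hcovL, hcovL, ← lintegral_add_left' hΓm]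
    exact setLIntegral_mono' measurableSet_Ioo hC1
  have hI2 : ∫⁻ x in Ioc (c - r) c, oscLine h r x ≤
      D * ENNReal.ofReal r + ∫⁻ x in Ioc (c - r) c, k x := by
    refine (setLIntegral_mono' measurableSet_Ioc hC2).trans ?_
    rw [lintegral_add_left measurable_const, setLIntegral_const, Real.volume_Ioc, sub_sub_cancel]
  have hI3 : ∫⁻ x in Iic (c - r), oscLine h r x = 0 := by
    rw [setLIntegral_congr_fun measurableSet_Iic hC3]; simp
  have hdisj : Disjoint (T '' Ioo 0 L) (Ioc (c - r) c) := by
    refine Set.disjoint_left.2 ?_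
    rintro _ ⟨t, ht, rfl⟩ h2
    have := hc1 t (hsub ht)
    have : 0 < s * t := mul_pos hs0 ht.1
    linarith [h2.2]
  have hcover : Iio (T L) ⊆ Iic (c - r) ∪ (T '' Ioo 0 L ∪ Ioc (c - r) c) := by
    intro x hx
    rcases le_or_gt x (c - r) with h1 | h1
    · exact Or.inl h1
    rcases le_or_gt x c with h2 | h2
    · exact Or.inr (Or.inr ⟨h1, h2⟩)
    · obtain ⟨t, ht, rfl⟩ := hc2 L ⟨hL, by linarith⟩ x ⟨h2, hx⟩
      exact Or.inr (Or.inl (mem_image_of_mem T ht))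
  calc ∫⁻ x in Iio (T L), oscLine h r x
      ≤ (∫⁻ x in Iic (c - r), oscLine h r x) + ((∫⁻ x in T '' Ioo 0 L, oscLine h r x) +
          ∫⁻ x in Ioc (c - r) c, oscLine h r x) :=
        (lintegral_mono_set hcover).trans ((lintegral_union_le _ _ _).trans
          (add_le_add le_rfl (lintegral_union_le _ _ _)))
    _ ≤ 0 + (((∫⁻ t in Ioo 0 L, Γ t) + ∫⁻ x in T '' Ioo 0 L, k x) +
          (D * ENNReal.ofReal r + ∫⁻ x in Ioc (c - r) c, k x)) :=
        add_le_add hI3.le (add_le_add hI1 hI2)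
    -- The two integrals of `k` are over disjoint sets, so the jump is paid once.
    _ = (∫⁻ t in Ioo 0 L, Γ t) + D * ENNReal.ofReal r +
          ∫⁻ x in T '' Ioo 0 L ∪ Ioc (c - r) c, k x := by
        rw [lintegral_union measurableSet_Ioc hdisj]; ring
    _ ≤ (1 + H) ^ 2 * ((∫⁻ t in Ioo 0 L, W t) + H * ∫⁻ t in Ioo 0 L, ‖F t‖ₑ) +
          ((1 + H) * (ENNReal.ofReal ρ * O) + H * ∫⁻ t in Ioo 0 (2 * ρ), ‖F t‖ₑ) +
          ∫⁻ t in Ioo 0 (2 * ρ), ‖F t‖ₑ := by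
        rw [hΓint]
        refine add_le_add (add_le_add le_rfl (hrD.trans ?_))
          ((setLIntegral_le_lintegral _ _).trans hkint)
        gcongr
        linarith
    _ = (1 + H) ^ 2 * ((∫⁻ t in Ioo 0 L, W t) + H * ∫⁻ t in Ioo 0 L, ‖F t‖ₑ) +
          (1 + H) * (ENNReal.ofReal ρ * O + ∫⁻ t in Ioo 0 (2 * ρ), ‖F t‖ₑ) := by ring
    _ ≤ (1 + H) ^ 2 * ((∫⁻ t in Ioo 0 L, W t) + H * ∫⁻ t in Ioo 0 L, ‖F t‖ₑ) +
          (1 + H) ^ 2 * (ENNReal.ofReal ρ * O + ∫⁻ t in Ioo 0 (2 * ρ), ‖F t‖ₑ) := by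
        gcongr
        exact le_self_pow le_self_add two_ne_zero
    _ = _ := by ring

/-! ### From half-branches to whole branches, by symmetry -/

theorem oscLine_comp_neg (h : ℝ → ℂ) (r x : ℝ) :
    oscLine (fun y => h (-y)) r x = oscLine h r (-x) := by
  refine le_antisymm (oscOn_le fun y₁ h₁ y₂ h₂ => ?_) (oscOn_le fun y₁ h₁ y₂ h₂ => ?_)
  · exact le_oscOn ⟨by linarith [h₁.2], by linarith [h₁.1]⟩ ⟨by linarith [h₂.2], by linarith [h₂.1]⟩
  · have := le_oscOn (F := fun y => h (-y)) (U := Ioo (x - r) (x + r)) (y₁ := -y₁) (y₂ := -y₂)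
      ⟨by linarith [h₁.2], by linarith [h₁.1]⟩ ⟨by linarith [h₂.2], by linarith [h₂.1]⟩
    simp only [neg_neg] at this
    exact this

theorem setLIntegral_Iio_neg (G : ℝ → ℝ≥0∞) (m : ℝ) :
    ∫⁻ x in Iio (-m), G (-x) = ∫⁻ x in Ioi m, G x := by
  have := (Measure.measurePreserving_neg (volume : Measure ℝ)).setLIntegral_comp_emb
    (MeasurableEquiv.neg ℝ).measurableEmbedding G (Iio (-m))
  rw [this]; simp

theorem aemeasurable_comp_restrict_Ioo {f : ℝ → ℂ} {e : ℝ → ℝ} {I J : Set ℝ}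
    (he : MeasurePreserving e volume volume) (hJ : MeasurableSet J) (hIJ : I ⊆ e ⁻¹' J)
    (hf : AEMeasurable f (volume.restrict J)) :
    AEMeasurable (fun t => f (e t)) (volume.restrict I) :=
  AEMeasurable.mono_measure (hf.comp_quasiMeasurePreserving
    (he.restrict_preimage hJ).quasiMeasurePreserving) (Measure.restrict_mono_set _ hIJ)

/-- The cut is at the midpoint. Reflecting both source and target on the right half yields another
increasing map with its end at `0`, so the half-branch estimate applies twice, on disjoint halves.
-/
theorem lintegral_oscLine_increasing {u L s r ρ' A : ℝ} {θ₁ θ₂ B : ℝ≥0∞} {η : ℝ} (hL : 0 < L)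
    (hs : 1 < s) (hr : 0 < r) (hrL : r ≤ L) (hρ' : r / s < ρ') (hρL : ρ' ≤ L)
    (hE : EndControl L (r / s) ρ' A θ₁ θ₂ B) {τ d : ℝ → ℝ}
    (hτ : ∀ y ∈ Ioo u (u + 2 * L), HasDerivAt τ (d y) y)
    (hd : ∀ y ∈ Ioo u (u + 2 * L), s ≤ d y)
    (hb : BddBelow (τ '' Ioo u (u + 2 * L))) (hb' : BddAbove (τ '' Ioo u (u + 2 * L)))
    (hη : ∀ y₁ ∈ Ioo u (u + 2 * L), ∀ y₂ ∈ Ioo u (u + 2 * L), |y₁ - y₂| < 2 * ρ' →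
      |d y₁ - d y₂| ≤ η)
    {f h : ℝ → ℂ} (hfm : AEMeasurable f (volume.restrict (Ioo u (u + 2 * L))))
    (hh : ∀ y ∈ Ioo u (u + 2 * L), h (τ y) = f y / (d y : ℂ))
    (hh₀ : ∀ x, x ∉ τ '' Ioo u (u + 2 * L) → h x = 0) {W V : ℝ → ℝ≥0∞}
    (hWm : Measurable W) (hVm : Measurable V)
    (hW : DominatesOsc (Ioo u (u + 2 * L)) ρ' f W)
    (hV : DominatesOsc (Ioo u (u + 2 * L)) A f V) :
    ∫⁻ x, oscLine h r x ≤ (1 + ENNReal.ofReal η) ^ 2 *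
      ((1 + θ₁) * (∫⁻ t in Ioo u (u + 2 * L), W t) + θ₂ * (∫⁻ t in Ioo u (u + 2 * L), V t) +
        (ENNReal.ofReal η + B) * ∫⁻ t in Ioo u (u + 2 * L), ‖f t‖ₑ) := by
  have m₁ : ∀ t ∈ Ioo 0 (2 * L), t + u ∈ Ioo u (u + 2 * L) := fun t ht =>
    ⟨by linarith [ht.1], by linarith [ht.2]⟩
  have m₂ : ∀ t ∈ Ioo 0 (2 * L), u + 2 * L - t ∈ Ioo u (u + 2 * L) := fun t ht =>
    ⟨by linarith [ht.2], by linarith [ht.1]⟩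
  have hdom : ∀ (e : ℝ → ℝ), (∀ t₁ t₂, |e t₁ - e t₂| = |t₁ - t₂|) →
      (∀ t ∈ Ioo 0 (2 * L), e t ∈ Ioo u (u + 2 * L)) → ∀ R U,
      DominatesOsc (Ioo u (u + 2 * L)) R f U →
      DominatesOsc (Ioo 0 (2 * L)) R (fun t => f (e t)) (fun t => U (e t)) :=
    fun e he hm R U hU t ht t₁ ht₁ t₂ ht₂ d₁ d₂ =>
      hU _ (hm t ht) _ (hm _ ht₁) _ (hm _ ht₂) (by rwa [he]) (by rwa [he])
  have he₁ : ∀ t₁ t₂ : ℝ, |t₁ + u - (t₂ + u)| = |t₁ - t₂| := fun t₁ t₂ => by congr 1; ring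
  have he₂ : ∀ t₁ t₂ : ℝ, |u + 2 * L - t₁ - (u + 2 * L - t₂)| = |t₁ - t₂| := fun t₁ t₂ => by
    rw [abs_sub_comm]; congr 1; ring
  have hLL : Ioo 0 L ⊆ Ioo 0 (2 * L) := Ioo_subset_Ioo_right (by linarith)
  have left := lintegral_oscLine_half (T := fun t => τ (t + u)) (Tp := fun t => d (t + u))
    (F := fun t => f (t + u)) (h := h) (W := fun t => W (t + u)) (η := η) hL hs hr hrL hρ' hρL
    (fun t ht => (hτ _ (m₁ t ht)).comp_add_const t u)
    (fun t ht => hd _ (m₁ t ht))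
    (hb.mono (by rintro _ ⟨t, ht, rfl⟩; exact mem_image_of_mem τ (m₁ t ht)))
    (fun t₁ h₁ t₂ h₂ h => hη _ (m₁ _ h₁) _ (m₁ _ h₂) (by rwa [he₁]))
    (aemeasurable_comp_restrict_Ioo (measurePreserving_add_right volume u) measurableSet_Ioo
      (fun t ht => m₁ t (hLL ht)) hfm)
    (fun t ht => hh _ (m₁ t ht))
    (fun x hx => hh₀ x fun ⟨y, hy, hyx⟩ => hx ⟨y - u, ⟨by linarith [hy.1], by linarith [hy.2]⟩,
      by simpa using hyx⟩)
    (by fun_prop) (hdom _ he₁ m₁ _ _ hW)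
  have endl := hE (fun t => f (t + u)) (fun t => W (t + u)) (fun t => V (t + u)) (by fun_prop)
    (by fun_prop) (hdom _ he₁ m₁ _ _ hW) (hdom _ he₁ m₁ _ _ hV)
  have right := lintegral_oscLine_half (T := fun t => -τ (u + 2 * L - t))
    (Tp := fun t => d (u + 2 * L - t))
    (F := fun t => f (u + 2 * L - t)) (h := fun x => h (-x)) (W := fun t => W (u + 2 * L - t))
    (η := η) hL hs hr hrL hρ' hρL
    (fun t ht => by
      have := ((hτ _ (m₂ t ht)).comp_const_sub (u + 2 * L) t).neg
      rwa [neg_neg] at this)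
    (fun t ht => hd _ (m₂ t ht))
    (by
      obtain ⟨C, hC⟩ := hb'
      refine ⟨-C, ?_⟩
      rintro _ ⟨t, ht, rfl⟩
      exact neg_le_neg (hC (mem_image_of_mem τ (m₂ t ht))))
    (fun t₁ h₁ t₂ h₂ h => hη _ (m₂ _ h₁) _ (m₂ _ h₂) (by rwa [he₂]))
    (aemeasurable_comp_restrict_Ioo (Measure.measurePreserving_sub_left volume (u + 2 * L))
      measurableSet_Ioo (fun t ht => m₂ t (hLL ht)) hfm)
    (fun t ht => by simpa using hh _ (m₂ t ht))
    (fun x hx => hh₀ _ fun ⟨y, hy, hyx⟩ => hx ⟨u + 2 * L - y,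
      ⟨by linarith [hy.2], by linarith [hy.1]⟩, by simp [hyx]⟩)
    (by fun_prop) (hdom _ he₂ m₂ _ _ hW)
  have endr := hE (fun t => f (u + 2 * L - t)) (fun t => W (u + 2 * L - t))
    (fun t => V (u + 2 * L - t)) (by fun_prop) (by fun_prop) (hdom _ he₂ m₂ _ _ hW)
    (hdom _ he₂ m₂ _ _ hV)
  have sL : ∀ G : ℝ → ℝ≥0∞, ∫⁻ t in Ioo 0 L, G (t + u) = ∫⁻ t in Ioo u (u + L), G t := fun G => by
    rw [setLIntegral_Ioo_shift G, zero_add, add_comm]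
  have sR : ∀ G : ℝ → ℝ≥0∞,
      ∫⁻ t in Ioo 0 L, G (u + 2 * L - t) = ∫⁻ t in Ioo (u + L) (u + 2 * L), G t := fun G => by
    rw [setLIntegral_Ioo_reflect G, sub_zero]; congr 3; ring
  have sA : ∀ G : ℝ → ℝ≥0∞, ∫⁻ t in Ioo u (u + 2 * L), G t =
      (∫⁻ t in Ioo u (u + L), G t) + ∫⁻ t in Ioo (u + L) (u + 2 * L), G t := fun G =>
    (setLIntegral_Ioo_append G (by linarith) (by linarith)).symm
  simp only [sL W, sL V, sL fun t => ‖f t‖ₑ] at left endl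
  simp only [sR W, sR V, sR fun t => ‖f t‖ₑ] at right endr
  have e2 : u + 2 * L - L = L + u := by ring
  have hright : ∫⁻ x in Iio (-τ (u + 2 * L - L)), oscLine (fun y => h (-y)) r x =
      ∫⁻ x in Ici (τ (L + u)), oscLine h r x := by
    simp only [oscLine_comp_neg]
    rw [setLIntegral_Iio_neg (oscLine h r), e2]
    exact setLIntegral_congr Ioi_ae_eq_Ici
  rw [hright] at right
  rw [← lintegral_add_compl _ (measurableSet_Iio (a := τ (L + u))), compl_Iio, sA W, sA V,
    sA fun t => ‖f t‖ₑ]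
  refine (add_le_add (left.trans (mul_le_mul' le_rfl (add_le_add le_rfl endl)))
    (right.trans (mul_le_mul' le_rfl (add_le_add le_rfl endr)))).trans (le_of_eq ?_)
  ring

/-- A decreasing branch becomes increasing when only the target is reflected, which preserves `∫
osc`. -/
theorem lintegral_oscLine_branch {u L s r ρ' A : ℝ} {θ₁ θ₂ B : ℝ≥0∞} {η : ℝ} (hL : 0 < L)
    (hs : 1 < s) (hr : 0 < r) (hrL : r ≤ L) (hρ' : r / s < ρ') (hρL : ρ' ≤ L)
    (hE : EndControl L (r / s) ρ' A θ₁ θ₂ B) {τ d : ℝ → ℝ}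
    (hτ : ∀ y ∈ Ioo u (u + 2 * L), HasDerivAt τ (d y) y)
    (hd : (∀ y ∈ Ioo u (u + 2 * L), s ≤ d y) ∨ ∀ y ∈ Ioo u (u + 2 * L), s ≤ -d y)
    (hb : BddBelow (τ '' Ioo u (u + 2 * L))) (hb' : BddAbove (τ '' Ioo u (u + 2 * L)))
    (hη : ∀ y₁ ∈ Ioo u (u + 2 * L), ∀ y₂ ∈ Ioo u (u + 2 * L), |y₁ - y₂| < 2 * ρ' →
      |d y₁ - d y₂| ≤ η)
    {f h : ℝ → ℂ} (hfm : AEMeasurable f (volume.restrict (Ioo u (u + 2 * L))))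
    (hh : ∀ y ∈ Ioo u (u + 2 * L), h (τ y) = f y / ((|d y| : ℝ) : ℂ))
    (hh₀ : ∀ x, x ∉ τ '' Ioo u (u + 2 * L) → h x = 0) {W V : ℝ → ℝ≥0∞}
    (hWm : Measurable W) (hVm : Measurable V)
    (hW : DominatesOsc (Ioo u (u + 2 * L)) ρ' f W)
    (hV : DominatesOsc (Ioo u (u + 2 * L)) A f V) :
    ∫⁻ x, oscLine h r x ≤ (1 + ENNReal.ofReal η) ^ 2 *
      ((1 + θ₁) * (∫⁻ t in Ioo u (u + 2 * L), W t) + θ₂ * (∫⁻ t in Ioo u (u + 2 * L), V t) +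
        (ENNReal.ofReal η + B) * ∫⁻ t in Ioo u (u + 2 * L), ‖f t‖ₑ) := by
  rcases hd with hd | hd
  · refine lintegral_oscLine_increasing hL hs hr hrL hρ' hρL hE hτ hd hb hb' hη hfm
      (fun y hy => ?_) hh₀ hWm hVm hW hV
    rw [hh y hy, abs_of_pos (by linarith [hd y hy])]
  · have key := lintegral_oscLine_increasing (τ := fun y => -τ y) (d := fun y => -d y)
      (h := fun x => h (-x)) (η := η) hL hs hr hrL hρ' hρL hE (fun y hy => (hτ y hy).neg) hd
      (by
        obtain ⟨C, hC⟩ := hb'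
        refine ⟨-C, ?_⟩
        rintro _ ⟨t, ht, rfl⟩
        exact neg_le_neg (hC (mem_image_of_mem τ ht)))
      (by
        obtain ⟨C, hC⟩ := hb
        refine ⟨-C, ?_⟩
        rintro _ ⟨t, ht, rfl⟩
        exact neg_le_neg (hC (mem_image_of_mem τ ht)))
      (fun y₁ h₁ y₂ h₂ h => by
        rw [neg_sub_neg, abs_sub_comm]; exact hη y₁ h₁ y₂ h₂ h)
      hfm
      (fun y hy => by
        simp only [neg_neg]
        rw [hh y hy, abs_of_neg (by linarith [hd y hy])])
      (fun x hx => hh₀ _ fun ⟨y, hy, hyx⟩ => hx ⟨y, hy, by simp [hyx]⟩) hWm hVm hW hV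
    simp only [oscLine_comp_neg] at key
    rwa [lintegral_neg_eq_self] at key

/-! ### Measurability and elementary bounds for the oscillation -/

/-- Two points of an open ball stay in it when the centre moves slightly. This makes `osc f r`
measurable for an arbitrary `f`. -/
theorem lowerSemicontinuous_osc (f : ℝ → ℂ) (r : ℝ) : LowerSemicontinuous (osc f r) := by
  intro x c hc
  unfold osc at hc
  simp only [lt_iSup_iff] at hc
  obtain ⟨y₁, h₁, y₂, h₂, hlt⟩ := hc
  have hev : ∀ y ∈ relBall r x, ∀ᶠ x' in nhds x, y ∈ relBall r x' := fun y hy => by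
    have e1 : ∀ᶠ x' in nhds x, x' - r < y :=
      (continuous_id.sub continuous_const).continuousAt.eventually_lt continuousAt_const hy.1.1
    have e2 : ∀ᶠ x' in nhds x, y < x' + r :=
      continuousAt_const.eventually_lt (continuous_id.add continuous_const).continuousAt hy.1.2
    filter_upwards [e1, e2] with x' a b using ⟨⟨a, b⟩, hy.2⟩
  filter_upwards [hev _ h₁, hev _ h₂] with x' a b
  exact hlt.trans_le (le_oscOn (F := f) a b)

theorem measurable_osc (f : ℝ → ℂ) (r : ℝ) : Measurable (osc f r) :=
  (lowerSemicontinuous_osc f r).measurable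

theorem osc_le_oscLine (f : ℝ → ℂ) (r x : ℝ) : osc f r x ≤ oscLine f r x :=
  oscOn_mono inter_subset_left

theorem osc_sum_le {ι : Type*} (s : Finset ι) (f : ι → ℝ → ℂ) (r x : ℝ) :
    osc (fun y => ∑ i ∈ s, f i y) r x ≤ ∑ i ∈ s, osc (f i) r x := by
  refine oscOn_le fun y₁ h₁ y₂ h₂ => ?_
  rw [← Finset.sum_sub_distrib]
  exact (enorm_sum_le _ _).trans (Finset.sum_le_sum fun i _ => le_oscOn (F := f i) h₁ h₂)

theorem dominatesOsc_osc {U : Set ℝ} (hU : U ⊆ Icc 0 1) (f : ℝ → ℂ) (ρ : ℝ) :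
    DominatesOsc U ρ f (osc f ρ) := by
  intro t _ t₁ h₁ t₂ h₂ d₁ d₂
  rw [abs_lt] at d₁ d₂
  exact le_oscOn (F := f) (U := relBall ρ t) ⟨⟨by linarith, by linarith⟩, hU h₁⟩
    ⟨⟨by linarith, by linarith⟩, hU h₂⟩

theorem oscOne_le_varFun {A p ρ : ℝ} (h0 : 0 < ρ) (hρ : ρ ≤ A) (f : ℝ → ℂ) :
    oscOne f ρ ≤ ENNReal.ofReal (ρ ^ (1 / p)) * varFun A p f := by
  have h1 : oscOne f ρ / ENNReal.ofReal (ρ ^ (1 / p)) ≤ varFun A p f :=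
    le_iSup₂_of_le (f := fun r (_ : r ∈ Ioc (0 : ℝ) A) => oscOne f r / ENNReal.ofReal (r ^ (1 / p)))
      ρ ⟨h0, hρ⟩ le_rfl
  have h2 : ENNReal.ofReal (ρ ^ (1 / p)) ≠ 0 := by
    simpa using Real.rpow_pos_of_pos h0 _
  rwa [ENNReal.div_le_iff h2 ENNReal.ofReal_ne_top, mul_comm] at h1

/-! ### Branches of the Frobenius–Perron operator and change of variables -/

/-- The contribution to the Frobenius–Perron operator of the branch of `τ` over `I`. -/
noncomputable def branch (τ : ℝ → ℝ) (I : Set ℝ) (f : ℝ → ℂ) : ℝ → ℂ :=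
  (τ '' I).indicator fun z =>
    f (Function.invFunOn τ I z) / ((|deriv τ (Function.invFunOn τ I z)| : ℝ) : ℂ)

theorem frobeniusPerron_eq_sum (τ : ℝ → ℝ) {q : ℕ} (a : Fin (q + 1) → ℝ) (f : ℝ → ℂ) :
    frobeniusPerron τ a f = fun x => ∑ i, branch τ (piece a i) f x := rfl

theorem branch_apply {τ : ℝ → ℝ} {I : Set ℝ} (hI : InjOn τ I) (f : ℝ → ℂ) {y : ℝ} (hy : y ∈ I) :
    branch τ I f (τ y) = f y / ((|deriv τ y| : ℝ) : ℂ) := by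
  rw [branch, indicator_of_mem (mem_image_of_mem τ hy), hI.leftInvOn_invFunOn hy]

theorem branch_of_notMem {τ : ℝ → ℝ} {I : Set ℝ} (f : ℝ → ℂ) {x : ℝ} (hx : x ∉ τ '' I) :
    branch τ I f x = 0 := indicator_of_notMem hx _

theorem branch_sub (τ : ℝ → ℝ) (I : Set ℝ) (f g : ℝ → ℂ) (x : ℝ) :
    branch τ I (f - g) x = branch τ I f x - branch τ I g x := by
  by_cases hx : x ∈ τ '' I
  · simp only [branch, indicator_of_mem hx, Pi.sub_apply, sub_div]
  · simp only [branch_of_notMem _ hx, sub_zero]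

theorem frobeniusPerron_sub (τ : ℝ → ℝ) {q : ℕ} (a : Fin (q + 1) → ℝ) (f g : ℝ → ℂ) :
    frobeniusPerron τ a (f - g) = frobeniusPerron τ a f - frobeniusPerron τ a g := by
  ext x
  simp only [frobeniusPerron_eq_sum, branch_sub, Finset.sum_sub_distrib, Pi.sub_apply]

theorem integrable_branch {τ : ℝ → ℝ} {I : Set ℝ} (hIm : MeasurableSet I) (hI : InjOn τ I)
    (hd : ∀ y ∈ I, deriv τ y ≠ 0) {f : ℝ → ℂ} (hf : IntegrableOn f I) :
    Integrable (branch τ I f) := by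
  have hder : ∀ y ∈ I, HasDerivWithinAt τ (deriv τ y) I y := fun y hy =>
    (differentiableAt_of_deriv_ne_zero (hd y hy)).hasDerivAt.hasDerivWithinAt
  have him : MeasurableSet (τ '' I) :=
    hIm.image_of_continuousOn_injOn (fun y hy => (hder y hy).continuousWithinAt) hI
  have h1 : IntegrableOn (branch τ I f) (τ '' I) := by
    rw [integrableOn_image_iff_integrableOn_abs_deriv_smul hIm hder hI]
    refine hf.congr_fun (fun y hy => ?_) hIm
    have : ((|deriv τ y| : ℝ) : ℂ) ≠ 0 := by simpa using hd y hy
    rw [branch_apply hI f hy, Complex.real_smul]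
    field_simp
  have h2 := (integrable_indicator_iff him).2 h1
  rwa [branch, indicator_indicator, inter_self] at h2

theorem lintegral_enorm_branch {τ : ℝ → ℝ} {I : Set ℝ} (hIm : MeasurableSet I) (hI : InjOn τ I)
    (hd : ∀ y ∈ I, deriv τ y ≠ 0) (f : ℝ → ℂ) :
    ∫⁻ x, ‖branch τ I f x‖ₑ = ∫⁻ y in I, ‖f y‖ₑ := by
  have hder : ∀ y ∈ I, HasDerivWithinAt τ (deriv τ y) I y := fun y hy =>
    (differentiableAt_of_deriv_ne_zero (hd y hy)).hasDerivAt.hasDerivWithinAt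
  have him : MeasurableSet (τ '' I) :=
    hIm.image_of_continuousOn_injOn (fun y hy => (hder y hy).continuousWithinAt) hI
  have h0 : ∫⁻ x, ‖branch τ I f x‖ₑ = ∫⁻ x in τ '' I, ‖branch τ I f x‖ₑ := by
    refine (setLIntegral_eq_of_support_subset fun x hx => ?_).symm
    by_contra h
    simp [branch_of_notMem f h] at hx
  rw [h0, lintegral_image_eq_lintegral_abs_deriv_mul hIm hder hI]
  refine setLIntegral_congr_fun hIm fun y hy => ?_
  have hp : 0 < |deriv τ y| := abs_pos.2 (hd y hy)
  simp only [branch_apply hI f hy]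
  rw [div_eq_mul_inv, enorm_mul, ← Complex.ofReal_inv, ← ofReal_norm (Complex.ofReal _),
    Complex.norm_real, Real.norm_of_nonneg (by positivity), mul_comm ‖f y‖ₑ, ← mul_assoc,
    ← ENNReal.ofReal_mul hp.le, mul_inv_cancel₀ hp.ne', ENNReal.ofReal_one, one_mul]

theorem sum_lintegral_piece_le {q : ℕ} {a : Fin (q + 1) → ℝ} (ha : StrictMono a) (h0 : a 0 = 0)
    (h1 : a (Fin.last q) = 1) (G : ℝ → ℝ≥0∞) :
    ∑ i, ∫⁻ y in piece a i, G y ≤ ∫⁻ y, G y ∂lebI := by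
  have hdisj : Pairwise (Function.onFun Disjoint (piece a)) := by
    have key : ∀ i j : Fin q, i < j → Disjoint (piece a i) (piece a j) := fun i j hij => by
      refine Set.disjoint_left.2 fun x hx hx' => ?_
      have : a i.succ ≤ a j.castSucc := ha.monotone (by
        rw [Fin.le_def]; simpa using hij)
      linarith [hx.2, hx'.1]
    intro i j hij
    rcases lt_or_gt_of_ne hij with h | h
    · exact key i j h
    · exact (key j i h).symm
  have hm : ∀ i, MeasurableSet (piece a i) := fun i => measurableSet_Ioo
  rw [← tsum_fintype (L := .unconditional _), ← lintegral_iUnion hm hdisj]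
  refine lintegral_mono_set (iUnion_subset fun i x hx => ?_)
  have l0 : a 0 ≤ a i.castSucc := ha.monotone (Fin.zero_le _)
  have l1 : a i.succ ≤ a (Fin.last q) := ha.monotone (Fin.le_last _)
  exact ⟨by linarith [hx.1], by linarith [hx.2]⟩

/-! ### Piecewise expanding maps: `L¹` contraction and summation over branches -/

namespace IsPiecewiseExpanding

variable {ε : ℝ} {τ : ℝ → ℝ} {q : ℕ} {a : Fin (q + 1) → ℝ} {s : Fin q → ℝ}

theorem piece_subset (hτ : IsPiecewiseExpanding ε τ a s) (i : Fin q) : piece a i ⊆ Icc 0 1 := by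
  intro x hx
  have l0 : a 0 ≤ a i.castSucc := hτ.strictMono.monotone (Fin.zero_le _)
  have l1 : a i.succ ≤ a (Fin.last q) := hτ.strictMono.monotone (Fin.le_last _)
  rw [hτ.first] at l0
  rw [hτ.last] at l1
  exact ⟨by linarith [hx.1], by linarith [hx.2]⟩

theorem deriv_ne_zero (hτ : IsPiecewiseExpanding ε τ a s) {i : Fin q} {y : ℝ}
    (hy : y ∈ piece a i) : deriv τ y ≠ 0 := by
  have h1 := hτ.slope i y hy
  have h2 := hτ.one_lt i
  intro h
  rw [h, abs_zero] at h1
  linarith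

theorem hasDerivAt (hτ : IsPiecewiseExpanding ε τ a s) {i : Fin q} {y : ℝ}
    (hy : y ∈ piece a i) : HasDerivAt τ (deriv τ y) y :=
  (differentiableAt_of_deriv_ne_zero (hτ.deriv_ne_zero hy)).hasDerivAt

theorem slope_or (hτ : IsPiecewiseExpanding ε τ a s) (i : Fin q) :
    (∀ y ∈ piece a i, s i ≤ deriv τ y) ∨ ∀ y ∈ piece a i, s i ≤ -deriv τ y := by
  have ho : IsOpen (piece a i) := isOpen_Ioo
  rcases hτ.monotone i with h | h
  · refine Or.inl fun y hy => ?_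
    have h1 : 0 ≤ deriv τ y := by
      rw [← derivWithin_of_isOpen ho hy]; exact h.derivWithin_nonneg
    simpa [abs_of_nonneg h1] using hτ.slope i y hy
  · refine Or.inr fun y hy => ?_
    have h1 : deriv τ y ≤ 0 := by
      rw [← derivWithin_of_isOpen ho hy]; exact h.derivWithin_nonpos
    simpa [abs_of_nonpos h1] using hτ.slope i y hy

theorem injOn (hτ : IsPiecewiseExpanding ε τ a s) (i : Fin q) : InjOn τ (piece a i) := by
  have hc : ContinuousOn τ (piece a i) := fun y hy =>
    (hτ.hasDerivAt hy).continuousAt.continuousWithinAt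
  have h1 := hτ.one_lt i
  rcases hτ.slope_or i with h | h
  · exact (strictMonoOn_of_deriv_pos (convex_Ioo _ _) hc fun y hy => by
      linarith [h y (interior_subset hy)]).injOn
  · exact (strictAntiOn_of_deriv_neg (convex_Ioo _ _) hc fun y hy => by
      linarith [h y (interior_subset hy)]).injOn

theorem memLp_frobeniusPerron (hτ : IsPiecewiseExpanding ε τ a s) {f : ℝ → ℂ}
    (hf : MemLp f 1 lebI) : MemLp (frobeniusPerron τ a f) 1 lebI := by
  rw [memLp_one_iff_integrable] at hf ⊢
  rw [frobeniusPerron_eq_sum]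
  refine integrable_finsetSum _ fun i _ => Integrable.restrict ?_
  exact integrable_branch measurableSet_Ioo (hτ.injOn i) (fun y hy => hτ.deriv_ne_zero hy)
    (IntegrableOn.mono_set hf (hτ.piece_subset i))

theorem eLpNorm_frobeniusPerron_le (hτ : IsPiecewiseExpanding ε τ a s) {f : ℝ → ℂ}
    (hf : MemLp f 1 lebI) : eLpNorm (frobeniusPerron τ a f) 1 lebI ≤ eLpNorm f 1 lebI := by
  rw [eLpNorm_one_eq_lintegral_enorm, eLpNorm_one_eq_lintegral_enorm, frobeniusPerron_eq_sum]
  have hi : ∀ i, Integrable (branch τ (piece a i) f) := fun i =>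
    integrable_branch measurableSet_Ioo (hτ.injOn i) (fun y hy => hτ.deriv_ne_zero hy)
    (IntegrableOn.mono_set (memLp_one_iff_integrable.1 hf) (hτ.piece_subset i))
  calc ∫⁻ x, ‖∑ i, branch τ (piece a i) f x‖ₑ ∂lebI
      ≤ ∫⁻ x, ∑ i, ‖branch τ (piece a i) f x‖ₑ := by
        refine (setLIntegral_le_lintegral _ _).trans (lintegral_mono fun x => enorm_sum_le _ _)
    _ = ∑ i, ∫⁻ x, ‖branch τ (piece a i) f x‖ₑ :=
        lintegral_finsetSum' _ fun i _ => (hi i).aestronglyMeasurable.enorm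
    _ = ∑ i, ∫⁻ y in piece a i, ‖f y‖ₑ := Finset.sum_congr rfl fun i _ =>
        lintegral_enorm_branch measurableSet_Ioo (hτ.injOn i) (fun y hy => hτ.deriv_ne_zero hy) f
    _ ≤ _ := sum_lintegral_piece_le hτ.strictMono hτ.first hτ.last _

/-- The operator respects differences and contracts `L¹`, so it sends the null function `g - f` to a
null function. -/
theorem frobeniusPerron_congr_ae (hτ : IsPiecewiseExpanding ε τ a s) {f g : ℝ → ℂ}
    (hfg : g =ᵐ[lebI] f) : frobeniusPerron τ a g =ᵐ[lebI] frobeniusPerron τ a f := by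
  have h0 : g - f =ᵐ[lebI] 0 := by
    filter_upwards [hfg] with x hx
    simp [hx]
  have hm : MemLp (g - f) 1 lebI := (memLp_congr_ae h0).2 MemLp.zero
  have h1 := hτ.eLpNorm_frobeniusPerron_le hm
  rw [eLpNorm_congr_ae h0, eLpNorm_zero, nonpos_iff_eq_zero,
    eLpNorm_eq_zero_iff (hτ.memLp_frobeniusPerron hm).1 one_ne_zero, frobeniusPerron_sub] at h1
  filter_upwards [h1] with x hx
  simpa [sub_eq_zero] using hx

theorem oscOne_frobeniusPerron_le (hτ : IsPiecewiseExpanding ε τ a s) {σ r ρ' A η : ℝ}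
    {θ₁ θ₂ B : ℝ≥0∞} (hσ : 1 < σ) (hσs : ∀ i, σ ≤ s i) (hr : 0 < r)
    (hrL : ∀ i : Fin q, r ≤ (a i.succ - a i.castSucc) / 2) (hρ' : r / σ < ρ') (hρr : ρ' ≤ r)
    (hE : ∀ i : Fin q, EndControl ((a i.succ - a i.castSucc) / 2) (r / σ) ρ' A θ₁ θ₂ B)
    (hη : ∀ i, ∀ y₁ ∈ piece a i, ∀ y₂ ∈ piece a i, |y₁ - y₂| < 2 * ρ' →
      |deriv τ y₁ - deriv τ y₂| ≤ η) {f : ℝ → ℂ} (hf : AEMeasurable f lebI) :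
    oscOne (frobeniusPerron τ a f) r ≤ (1 + ENNReal.ofReal η) ^ 2 *
      ((1 + θ₁) * oscOne f ρ' + θ₂ * oscOne f A +
        (ENNReal.ofReal η + B) * eLpNorm f 1 lebI) := by
  have hbranch : ∀ i, ∫⁻ x, oscLine (branch τ (piece a i) f) r x ≤ (1 + ENNReal.ofReal η) ^ 2 *
      ((1 + θ₁) * (∫⁻ t in piece a i, osc f ρ' t) + θ₂ * (∫⁻ t in piece a i, osc f A t) +
        (ENNReal.ofReal η + B) * ∫⁻ t in piece a i, ‖f t‖ₑ) := by
    intro i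
    have hlt : a i.castSucc < a i.succ := hτ.strictMono Fin.castSucc_lt_succ
    have hp : piece a i = Ioo (a i.castSucc)
        (a i.castSucc + 2 * ((a i.succ - a i.castSucc) / 2)) := by
      rw [piece]; congr 1; ring
    have hsub := hτ.piece_subset i
    have hmaps : τ '' piece a i ⊆ Icc 0 1 := (image_mono hsub).trans hτ.mapsTo.image_subset
    have key := fun hd hbb hba => lintegral_oscLine_branch (u := a i.castSucc)
      (L := (a i.succ - a i.castSucc) / 2) (s := σ) (d := deriv τ) (τ := τ) (f := f)
      (h := branch τ (piece a i) f) (η := η) (W := osc f ρ') (V := osc f A)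
      (by linarith) hσ hr (hrL i) hρ' (hρr.trans (hrL i)) (hE i)
      (by rw [← hp]; exact fun y hy => hτ.hasDerivAt hy) hd hbb hba
      (by rw [← hp]; exact hη i)
      (by rw [← hp]; exact AEMeasurable.mono_measure hf (Measure.restrict_mono_set _ hsub))
      (by rw [← hp]; exact fun y hy => branch_apply (hτ.injOn i) f hy)
      (by rw [← hp]; exact fun x hx => branch_of_notMem f hx)
      (measurable_osc _ _) (measurable_osc _ _)
      (by rw [← hp]; exact dominatesOsc_osc hsub f ρ')
      (by rw [← hp]; exact dominatesOsc_osc hsub f A)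
    rw [← hp] at key
    refine key ?_ (bddBelow_Icc.mono hmaps) (bddAbove_Icc.mono hmaps)
    exact (hτ.slope_or i).imp (fun h y hy => (hσs i).trans (h y hy))
      (fun h y hy => (hσs i).trans (h y hy))
  have hsum := fun G => sum_lintegral_piece_le hτ.strictMono hτ.first hτ.last G
  calc oscOne (frobeniusPerron τ a f) r
      ≤ ∫⁻ x, ∑ i, osc (branch τ (piece a i) f) r x ∂lebI := by
        rw [frobeniusPerron_eq_sum]
        exact lintegral_mono fun x => osc_sum_le _ _ _ _
    _ = ∑ i, ∫⁻ x, osc (branch τ (piece a i) f) r x ∂lebI :=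
        lintegral_finsetSum _ fun i _ => measurable_osc _ _
    _ ≤ ∑ i, (1 + ENNReal.ofReal η) ^ 2 * ((1 + θ₁) * (∫⁻ t in piece a i, osc f ρ' t) +
        θ₂ * (∫⁻ t in piece a i, osc f A t) +
        (ENNReal.ofReal η + B) * ∫⁻ t in piece a i, ‖f t‖ₑ) :=
        Finset.sum_le_sum fun i _ => ((setLIntegral_le_lintegral _ _).trans
          (lintegral_mono fun x => osc_le_oscLine _ _ _)).trans (hbranch i)
    _ ≤ _ := by
        rw [← Finset.mul_sum, Finset.sum_add_distrib, Finset.sum_add_distrib, ← Finset.mul_sum,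
          ← Finset.mul_sum, ← Finset.mul_sum, eLpNorm_one_eq_lintegral_enorm]
        gcongr
        · exact hsum _
        · exact hsum _
        · exact hsum _

end IsPiecewiseExpanding

/-! ### Choosing the end estimate at each scale -/

/-- The end must cost no more than `σ⁻¹ r^{1/p}` in variation, up to the factor `l`. For `p = 1` the
chain does this with `θ₁ = 1`. For `p > 1`, `θ₂ A^{1/p}` carries the factor `(r / A)^{1-1/p}`, and
the small or large estimate is used according to `r / A`. -/
theorem exists_endControl {p σ l ℓ A : ℝ} (hp : 1 ≤ p) (hσ : 1 < σ) (hl : 1 < l) (hlσ : l ≤ σ)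
    (hA : 0 < A) (hAℓ : 2 * A ≤ ℓ) :
    ∃ b : ℝ, 0 ≤ b ∧ ∀ r ∈ Ioc 0 A, ∃ θ₁ θ₂ B : ℝ, 0 ≤ θ₁ ∧ 0 ≤ θ₂ ∧ 0 ≤ B ∧
      (∀ L, ℓ ≤ L → EndControl L (r / σ) (l * (r / σ)) A (ENNReal.ofReal θ₁) (ENNReal.ofReal θ₂)
        (ENNReal.ofReal B)) ∧
      (1 + θ₁) * (l * (r / σ)) ^ (1 / p) + θ₂ * A ^ (1 / p) ≤
        l * (σ ^ (-(1 / p)) + σ⁻¹) * r ^ (1 / p) ∧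
      B ≤ b * r ^ (1 / p) := by
  have hσ0 : 0 < σ := by linarith
  have hρ : ∀ r ∈ Ioc 0 A, 0 < r / σ ∧ r / σ < l * (r / σ) ∧ l * (r / σ) ≤ r ∧ r / σ ≤ r := by
    intro r hr
    have h0 : 0 < r / σ := div_pos hr.1 hσ0
    refine ⟨h0, by nlinarith, ?_, div_le_self hr.1.le hσ.le⟩
    calc l * (r / σ) ≤ σ * (r / σ) := by gcongr
      _ = r := by field_simp
  rcases hp.eq_or_lt with rfl | hp1
  · refine ⟨4 / ℓ, div_nonneg (by norm_num) (by linarith), fun r hr => ?_⟩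
    obtain ⟨h1, h2, h3, h4⟩ := hρ r hr
    refine ⟨1, 0, 4 * (r / σ) / ℓ, zero_le_one, le_rfl, div_nonneg (by positivity) (by linarith),
      fun L hL => ?_, ?_, ?_⟩
    · rw [ENNReal.ofReal_one, ENNReal.ofReal_zero]
      exact endControl_chain h1 h2 (by linarith [hr.2]) (by linarith) hL (by linarith [hr.2])
    · simp only [div_one, Real.rpow_one, zero_mul, add_zero, Real.rpow_neg_one]
      exact le_of_eq (by field_simp)
    · simp only [div_one, Real.rpow_one]
      rw [div_mul_eq_mul_div]
      gcongr
      linarith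
  · set ε := 1 / p with hε
    have hε0 : 0 < ε := by positivity
    have hε1 : ε < 1 := by rw [hε, div_lt_one (by linarith)]; exact hp1
    -- The threshold for `r / A` at which `3 (r / A)^{1-ε} = 1`.
    set c : ℝ := (1 / 3) ^ (1 / (1 - ε)) with hc
    have hc0 : 0 < c := by positivity
    have hc3 : c ^ (1 - ε) = 1 / 3 := by
      rw [hc, ← Real.rpow_mul (by norm_num), one_div_mul_cancel (by linarith), Real.rpow_one]
    have hc1 : c ≤ 1 / 3 := by
      rw [hc]
      calc ((1 : ℝ) / 3) ^ (1 / (1 - ε)) ≤ (1 / 3) ^ (1 : ℝ) :=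
            Real.rpow_le_rpow_of_exponent_ge (by norm_num) (by norm_num) (by
              rw [le_div_iff₀ (by linarith)]; linarith)
        _ = 1 / 3 := Real.rpow_one _
    have hfirst : ∀ r ∈ Ioc 0 A, (l * (r / σ)) ^ ε ≤ l * σ ^ (-ε) * r ^ ε := by
      intro r hr
      rw [Real.mul_rpow (by linarith) (by have := (hρ r hr).1; linarith),
        Real.div_rpow hr.1.le hσ0.le, Real.rpow_neg hσ0.le, mul_assoc, mul_comm _ (r ^ ε),
        div_eq_mul_inv]
      have : l ^ ε ≤ l := by
        calc l ^ ε ≤ l ^ (1 : ℝ) := Real.rpow_le_rpow_of_exponent_le hl.le hε1.le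
          _ = l := Real.rpow_one l
      gcongr
      exact mul_nonneg (Real.rpow_nonneg hr.1.le _) (by positivity)
    have hid : ∀ r ∈ Ioc 0 A, r / A * A ^ ε = r ^ ε * (r / A) ^ (1 - ε) := by
      intro r hr
      have hrA : 0 < r / A := div_pos hr.1 hA
      have h1 : 0 < r ^ ε := Real.rpow_pos_of_pos hr.1 _
      have h2 : 0 < A ^ ε := Real.rpow_pos_of_pos hA _
      rw [Real.rpow_sub hrA, Real.rpow_one, Real.div_rpow hr.1.le hA.le]
      field_simp
    have hcA : 0 < (c * A) ^ ε := Real.rpow_pos_of_pos (by positivity) _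
    have hAε : 0 < A ^ ε := Real.rpow_pos_of_pos hA _
    refine ⟨1 / (c * A) ^ ε + 2 / A ^ ε, by positivity, fun r hr => ?_⟩
    obtain ⟨h1, h2, h3, h4⟩ := hρ r hr
    have hr0 : 0 < r := hr.1
    have hrε : 0 < r ^ ε := Real.rpow_pos_of_pos hr0 _
    have hrA : r / A ≤ 1 := (div_le_one hA).2 hr.2
    have hrA0 : 0 < r / A := div_pos hr0 hA
    have hX : (r / A) ^ (1 - ε) ≤ 1 := Real.rpow_le_one hrA0.le hrA (by linarith)
    have hσi : 0 < σ⁻¹ := by positivity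
    rcases le_or_gt r (c * A) with hcase | hcase
    · have hrc : r / A ≤ c := (div_le_iff₀ hA).2 hcase
      have hX3 : (r / A) ^ (1 - ε) ≤ 1 / 3 := by
        rw [← hc3]; exact Real.rpow_le_rpow hrA0.le hrc (by linarith)
      refine ⟨0, 3 * (r / σ) / A, 2 * (r / σ) / A, le_rfl, by positivity, by positivity,
        fun L hL => ?_, ?_, ?_⟩
      · rw [ENNReal.ofReal_zero]
        exact endControl_small h1.le (by linarith [hr.2]) hA (by linarith)
          (by nlinarith)
      · have e : 3 * (r / σ) / A * A ^ ε = σ⁻¹ * (r ^ ε * (3 * (r / A) ^ (1 - ε))) := by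
          calc _ = 3 * σ⁻¹ * (r / A * A ^ ε) := by ring
            _ = _ := by rw [hid r hr]; ring
        rw [e, add_zero, one_mul]
        have : σ⁻¹ * (r ^ ε * (3 * (r / A) ^ (1 - ε))) ≤ l * (σ⁻¹ * r ^ ε) := by
          have h5 : r ^ ε * (3 * (r / A) ^ (1 - ε)) ≤ r ^ ε * 1 := by gcongr; linarith
          have h6 : 0 < σ⁻¹ * r ^ ε := by positivity
          calc _ ≤ σ⁻¹ * (r ^ ε * 1) := by gcongr
            _ ≤ _ := by nlinarith
        linarith [hfirst r hr, this]
      · have e : 2 * (r / A) = 2 / A ^ ε * (r / A * A ^ ε) := by field_simp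
        calc 2 * (r / σ) / A ≤ 2 * r / A := by gcongr
          _ = 2 / A ^ ε * (r ^ ε * (r / A) ^ (1 - ε)) := by rw [← hid r hr, ← e]; ring
          _ ≤ 2 / A ^ ε * (r ^ ε * 1) := by gcongr
          _ ≤ _ := by
            have : 0 ≤ 1 / (c * A) ^ ε * r ^ ε := by positivity
            linarith
    · refine ⟨0, r / σ / A, 1, le_rfl, by positivity, zero_le_one, fun L hL => ?_, ?_, ?_⟩
      · rw [ENNReal.ofReal_zero, ENNReal.ofReal_one]
        exact endControl_large (by linarith [hr.2]) hA (by linarith) (by linarith [hr.2])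
      · have e : r / σ / A * A ^ ε = σ⁻¹ * (r ^ ε * (r / A) ^ (1 - ε)) := by
          rw [← hid r hr]; ring
        rw [e, add_zero, one_mul]
        have : σ⁻¹ * (r ^ ε * (r / A) ^ (1 - ε)) ≤ l * (σ⁻¹ * r ^ ε) := by
          have h6 : 0 < σ⁻¹ * r ^ ε := by positivity
          calc _ ≤ σ⁻¹ * (r ^ ε * 1) := by gcongr
            _ ≤ _ := by nlinarith
        linarith [hfirst r hr, this]
      · have h5 : (c * A) ^ ε ≤ r ^ ε := Real.rpow_le_rpow (by positivity) hcase.le hε0.le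
        have h6 : 1 ≤ 1 / (c * A) ^ ε * r ^ ε := by
          rw [one_div_mul_eq_div, le_div_iff₀ hcA]; linarith
        have : 0 ≤ 2 / A ^ ε * r ^ ε := by positivity
        linarith

/-! ### Dependence on `A`, and passage to equivalence classes -/

/-- The oscillation over the whole interval is controlled by the oscillations at a small scale. -/
theorem oscOn_Icc_mul_le {κ A : ℝ} (hκ : 0 < κ) (hκ1 : κ ≤ 1) (hκA : κ ≤ A) (n : ℕ)
    (hn : 2 ≤ κ * n) (g : ℝ → ℂ) :
    ENNReal.ofReal (κ / 2) * oscOn g (Icc 0 1) ≤ n * oscOne g A := by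
  have hstep : ∀ y ∈ Icc (0 : ℝ) 1, ∀ y' ∈ Icc (0 : ℝ) 1, |y' - y| ≤ κ / 2 →
      ENNReal.ofReal (κ / 2) * ‖g y - g y'‖ₑ ≤ oscOne g A := by
    intro y hy y' hy' hd
    rw [abs_le] at hd
    -- An interval of length `κ / 2` on the side of `y` facing the middle of `[0, 1]`. Each of its
    -- points is within `κ ≤ A` of both `y` and `y'`.
    obtain ⟨z, hz, hz', hz1⟩ : ∃ z, y - κ / 2 ≤ z ∧ z ≤ y ∧ Ioo z (z + κ / 2) ⊆ Icc 0 1 := by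
      rcases le_total y (1 / 2) with h | h
      · exact ⟨y, by linarith, le_rfl, fun t ht => ⟨by linarith [hy.1, ht.1], by linarith [ht.2]⟩⟩
      · exact ⟨y - κ / 2, le_rfl, by linarith,
          fun t ht => ⟨by linarith [ht.1], by linarith [ht.2, hy.2]⟩⟩
    have h1 : ∫⁻ _ in Ioo z (z + κ / 2), ‖g y - g y'‖ₑ ≤ ∫⁻ t in Ioo z (z + κ / 2), osc g A t := by
      refine setLIntegral_mono' measurableSet_Ioo fun t ht => ?_
      have := ht.1
      have := ht.2
      exact le_oscOn (F := g) (U := relBall A t) ⟨⟨by linarith, by linarith⟩, hy⟩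
        ⟨⟨by linarith, by linarith⟩, hy'⟩
    rw [setLIntegral_const, Real.volume_Ioo, add_sub_cancel_left, mul_comm] at h1
    exact h1.trans (lintegral_mono_set hz1)
  have hn0 : (0 : ℝ) < n := by
    by_contra! h
    nlinarith
  refine mul_oscOn_le fun y hy y' hy' => ?_
  have hmem : ∀ k : ℕ, k ≤ n → y + k / n * (y' - y) ∈ Icc (0 : ℝ) 1 := fun k hk => by
    have hk' : (k : ℝ) / n ≤ 1 := (div_le_one hn0).2 (by exact_mod_cast hk)
    exact (convex_Icc (0 : ℝ) 1).add_smul_sub_mem hy hy' ⟨by positivity, hk'⟩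
  have hind : ∀ k : ℕ, k ≤ n →
      ENNReal.ofReal (κ / 2) * ‖g y - g (y + k / n * (y' - y))‖ₑ ≤ k * oscOne g A := by
    intro k
    induction k with
    | zero => simp
    | succ k ih =>
      intro hk
      have h1 := ih (by omega)
      have h2 := hstep _ (hmem k (by omega)) _ (hmem (k + 1) hk) (by
        have e : y + ((k + 1 : ℕ) : ℝ) / n * (y' - y) - (y + k / n * (y' - y)) = (y' - y) / n := by
          push_cast; field_simp; ring
        have : |y' - y| ≤ 1 := by
          rw [abs_le]; constructor <;> linarith [hy.1, hy.2, hy'.1, hy'.2]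
        rw [e, abs_div, abs_of_pos hn0, div_le_iff₀ hn0]
        linarith)
      calc ENNReal.ofReal (κ / 2) * ‖g y - g (y + (k + 1 : ℕ) / n * (y' - y))‖ₑ
          ≤ ENNReal.ofReal (κ / 2) * (‖g y - g (y + k / n * (y' - y))‖ₑ +
            ‖g (y + k / n * (y' - y)) - g (y + (k + 1 : ℕ) / n * (y' - y))‖ₑ) := by
            gcongr
            exact (congrArg _ (sub_add_sub_cancel _ _ _)).symm.le.trans (enorm_add_le _ _)
        _ ≤ k * oscOne g A + oscOne g A := by rw [mul_add]; exact add_le_add h1 h2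
        _ = _ := by push_cast; ring
  have := hind n le_rfl
  rwa [div_self hn0.ne', one_mul, add_sub_cancel] at this

theorem lebI_univ : lebI univ = 1 := by simp [lebI]

/-- Variations with different constants `A` are comparable. -/
theorem exists_varFun_le {p A₁ A : ℝ} (hp : 1 ≤ p) (hA₁ : 0 < A₁) :
    ∃ C : ℝ, 0 < C ∧ ∀ g : ℝ → ℂ, varFun A p g ≤ ENNReal.ofReal C * varFun A₁ p g := by
  set κ := min A₁ 1
  have hκ : 0 < κ := lt_min hA₁ one_pos
  obtain ⟨n, hn⟩ := exists_nat_ge (2 / κ)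
  have hn' : 2 ≤ κ * n := by rw [div_le_iff₀ hκ] at hn; linarith
  refine ⟨1 + 2 / κ * n, by positivity, fun g => iSup₂_le fun r hr => ?_⟩
  have hrε : 0 < r ^ (1 / p) := Real.rpow_pos_of_pos hr.1 _
  rw [ENNReal.div_le_iff (by simpa using hrε) ENNReal.ofReal_ne_top]
  rcases le_or_gt r A₁ with h | h
  · rw [mul_comm]
    refine (oscOne_le_varFun (p := p) hr.1 h g).trans ?_
    gcongr
    refine le_mul_of_one_le_left' ?_
    rw [ENNReal.one_le_ofReal]
    have : 0 ≤ 2 / κ * n := by positivity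
    linarith
  -- Above `A₁` the oscillation over all of `I` suffices, since `r^{1/p} ≥ A₁^{1/p}`.
  · have h1 : oscOne g r ≤ oscOn g (Icc 0 1) := by
      calc oscOne g r ≤ ∫⁻ _, oscOn g (Icc 0 1) ∂lebI :=
            lintegral_mono fun x => oscOn_mono inter_subset_right
        _ = _ := by rw [lintegral_const, lebI_univ, mul_one]
    have h2 := oscOn_Icc_mul_le hκ (min_le_right _ _) (min_le_left A₁ 1) n hn' g
    have e : ENNReal.ofReal (2 / κ) * ENNReal.ofReal (κ / 2) = 1 := by
      rw [← ENNReal.ofReal_mul (by positivity), ← ENNReal.ofReal_one]; congr 1; field_simp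
    calc oscOne g r ≤ ENNReal.ofReal (2 / κ) * (ENNReal.ofReal (κ / 2) * oscOn g (Icc 0 1)) := by
          rw [← mul_assoc, e, one_mul]; exact h1
      _ ≤ ENNReal.ofReal (2 / κ) * (n * (ENNReal.ofReal (A₁ ^ (1 / p)) * varFun A₁ p g)) := by
          exact mul_le_mul' le_rfl (h2.trans (mul_le_mul' le_rfl (oscOne_le_varFun hA₁ le_rfl g)))
      _ = ENNReal.ofReal (2 / κ * n) * varFun A₁ p g * ENNReal.ofReal (A₁ ^ (1 / p)) := by
          rw [ENNReal.ofReal_mul (by positivity), ENNReal.ofReal_natCast]; ring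
      _ ≤ _ := by
          gcongr
          linarith

theorem varClass_le_of_forall {A p C : ℝ} (hC : 0 < C) {f : ℝ → ℂ} {X Y : ℝ≥0∞}
    (h : ∀ g, g =ᵐ[lebI] f → X ≤ ENNReal.ofReal C * varFun A p g + Y) :
    X ≤ ENNReal.ofReal C * varClass A p f + Y := by
  have hC' : ENNReal.ofReal C ≠ 0 := by simpa using hC
  rw [← tsub_le_iff_right, mul_comm, ← ENNReal.div_le_iff hC' ENNReal.ofReal_ne_top]
  refine le_iInf₂ fun g hg => ?_
  rw [ENNReal.div_le_iff hC' ENNReal.ofReal_ne_top, tsub_le_iff_right, mul_comm]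
  exact h g hg

theorem varClass_mono {A₁ A p : ℝ} (h : A₁ ≤ A) (f : ℝ → ℂ) : varClass A₁ p f ≤ varClass A p f :=
  iInf₂_mono fun _ _ => biSup_mono fun _ hr => ⟨hr.1, hr.2.trans h⟩

theorem exists_varClass_le {p A₁ A : ℝ} (hp : 1 ≤ p) (hA₁ : 0 < A₁) :
    ∃ C : ℝ, 0 < C ∧ ∀ f : ℝ → ℂ, varClass A p f ≤ ENNReal.ofReal C * varClass A₁ p f := by
  obtain ⟨C, hC, h⟩ := exists_varFun_le (A := A) hp hA₁
  refine ⟨C, hC, fun f => ?_⟩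
  rw [← add_zero (ENNReal.ofReal C * _)]
  refine varClass_le_of_forall hC fun g hg => ?_
  rw [add_zero]
  exact (iInf₂_le g hg).trans (h g)

/-! ### The variation inequality for small `A` -/

namespace IsPiecewiseExpanding

theorem exists_varFun_frobeniusPerron_le {p : ℝ} (hp : 1 ≤ p) {τ : ℝ → ℝ} {q : ℕ}
    {a : Fin (q + 1) → ℝ} {s : Fin q → ℝ} (hτ : IsPiecewiseExpanding (1 / p) τ a s) {σ : ℝ}
    (hσ : 1 < σ) (hσs : ∀ i, σ ≤ s i) {α : ℝ} (hα : σ ^ (-(1 / p)) + σ⁻¹ < α) :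
    ∃ A₀ > (0 : ℝ), ∀ A ∈ Ioc (0 : ℝ) A₀, ∃ β > (0 : ℝ), ∀ f : ℝ → ℂ, AEMeasurable f lebI →
      varFun A p (frobeniusPerron τ a f) ≤
        ENNReal.ofReal α * varFun A p f + ENNReal.ofReal β * eLpNorm f 1 lebI := by
  have hσ0 : 0 < σ := by linarith
  set κ := σ ^ (-(1 / p)) + σ⁻¹ with hκ
  have hκ0 : 0 < κ := by positivity
  set ε := 1 / p with hε
  have hε0 : 0 < ε := by positivity
  -- Of the three factors `1 + e`, two bound the distortion `(1 + η)²` and one enlarges the radius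
  -- to `ρ' = (1 + e) r / σ`. The condition `1 + e ≤ σ` keeps `ρ' ≤ r`.
  obtain ⟨e, he0, heσ, heα⟩ : ∃ e : ℝ, 0 < e ∧ 1 + e ≤ σ ∧ (1 + e) ^ 3 * κ ≤ α := by
    have h1 : ∀ᶠ e : ℝ in nhds 0, (1 + e) ^ 3 * κ < α := by
      refine ContinuousAt.eventually_lt (by fun_prop) continuousAt_const ?_
      simpa using hα
    have h2 : ∀ᶠ e : ℝ in nhds 0, 1 + e < σ :=
      ContinuousAt.eventually_lt (by fun_prop) continuousAt_const (by simpa using hσ)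
    obtain ⟨e, ⟨h3, h4⟩, h5⟩ := (((h1.and h2).filter_mono nhdsWithin_le_nhds).and
      (self_mem_nhdsWithin (a := (0 : ℝ)) (s := Ioi 0))).exists
    exact ⟨e, h5, h4.le, h3.le⟩
  obtain ⟨ℓ, hℓ0, hℓ⟩ : ∃ ℓ : ℝ, 0 < ℓ ∧ ∀ i : Fin q, ℓ ≤ (a i.succ - a i.castSucc) / 2 := by
    have hpos : ∀ i : Fin q, 0 < (a i.succ - a i.castSucc) / 2 := fun i =>
      half_pos (sub_pos.2 (hτ.strictMono Fin.castSucc_lt_succ))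
    rcases isEmpty_or_nonempty (Fin q) with h | h
    · exact ⟨1, one_pos, fun i => h.elim i⟩
    · obtain ⟨i₀, hi₀⟩ := Finite.exists_min fun i : Fin q => (a i.succ - a i.castSucc) / 2
      exact ⟨_, hpos i₀, hi₀⟩
  obtain ⟨M, hM0, hM⟩ : ∃ M : ℝ, 0 < M ∧ ∀ i, ∀ x ∈ piece a i, ∀ y ∈ piece a i,
      |deriv τ x - deriv τ y| ≤ M * |x - y| ^ ε := by
    choose m hm using hτ.holder
    refine ⟨1 + ∑ i, |m i|, by positivity, fun i x hx y hy => (hm i x hx y hy).trans ?_⟩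
    gcongr
    have := Finset.single_le_sum (f := fun i => |m i|) (fun i _ => abs_nonneg _) (Finset.mem_univ i)
    linarith [le_abs_self (m i)]
  -- Solves `M t^ε = e`, so `2A ≤ t` forces the distortion `M (2r)^ε ≤ e` for all `r ≤ A`.
  set t := (e / M) ^ p with ht
  have ht0 : 0 < t := by positivity
  refine ⟨min (ℓ / 2) (t / 2), by positivity, fun A hA => ?_⟩
  have hA0 : 0 < A := hA.1
  have hAℓ : 2 * A ≤ ℓ := by linarith [hA.2.trans (min_le_left _ _)]
  have hAt : 2 * A ≤ t := by linarith [hA.2.trans (min_le_right _ _)]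
  obtain ⟨b, hb0, hb⟩ := exists_endControl (l := 1 + e) hp hσ (by linarith) heσ hA0 hAℓ
  refine ⟨(1 + e) ^ 2 * (M * 2 ^ ε + b), by positivity, fun f hf => iSup₂_le fun r hr => ?_⟩
  obtain ⟨θ₁, θ₂, B, h1, h2, hB, hE, hvar, hBb⟩ := hb r hr
  have hr0 : 0 < r := hr.1
  have hrε : 0 < r ^ ε := Real.rpow_pos_of_pos hr0 _
  set η := M * (2 * r) ^ ε with hη
  have hη0 : 0 ≤ η := by positivity
  have hηe : η ≤ e := by
    have h3 : (2 * r) ^ ε ≤ t ^ ε := Real.rpow_le_rpow (by positivity) (by linarith [hr.2]) hε0.le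
    have h4 : t ^ ε = e / M := by
      rw [ht, hε, ← Real.rpow_mul (by positivity), mul_one_div_cancel (by linarith), Real.rpow_one]
    rw [h4, le_div_iff₀ hM0] at h3
    linarith
  have hρr : (1 + e) * (r / σ) ≤ r := by
    rw [mul_div_assoc', div_le_iff₀ hσ0]; nlinarith
  have hρ0 : 0 < r / σ := by positivity
  have key := hτ.oscOne_frobeniusPerron_le (η := η) hσ hσs hr0
    (fun i => by linarith [hℓ i, hr.2]) (ρ' := (1 + e) * (r / σ)) (by nlinarith) hρr
    (fun i => hE _ (hℓ i))
    (fun i y₁ h₁ y₂ h₂ hd => (hM i y₁ h₁ y₂ h₂).trans (by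
      rw [hη]; gcongr; linarith)) hf
  have v1 := oscOne_le_varFun (p := p) (A := A) (by positivity : 0 < (1 + e) * (r / σ))
    (hρr.trans hr.2) f
  have v2 := oscOne_le_varFun (p := p) hA0 le_rfl f
  rw [← hε] at v1 v2
  rw [ENNReal.div_le_iff (ENNReal.ofReal_pos.2 hrε).ne' ENNReal.ofReal_ne_top]
  set V := varFun A p f
  set N := eLpNorm f 1 lebI
  have hρε : 0 ≤ ((1 + e) * (r / σ)) ^ ε := by positivity
  have hAε : 0 ≤ A ^ ε := by positivity
  calc oscOne (frobeniusPerron τ a f) r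
      ≤ (1 + ENNReal.ofReal η) ^ 2 * ((1 + ENNReal.ofReal θ₁) *
          (ENNReal.ofReal (((1 + e) * (r / σ)) ^ ε) * V) +
          ENNReal.ofReal θ₂ * (ENNReal.ofReal (A ^ ε) * V) +
          (ENNReal.ofReal η + ENNReal.ofReal B) * N) := by
        refine key.trans ?_
        gcongr
    _ = ENNReal.ofReal ((1 + η) ^ 2 *
          ((1 + θ₁) * ((1 + e) * (r / σ)) ^ ε + θ₂ * A ^ ε)) * V +
          ENNReal.ofReal ((1 + η) ^ 2 * (η + B)) * N := by
        have hη2 : ENNReal.ofReal ((1 + η) ^ 2) = (1 + ENNReal.ofReal η) ^ 2 := by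
          rw [ENNReal.ofReal_pow (by positivity), ENNReal.ofReal_add zero_le_one hη0,
            ENNReal.ofReal_one]
        have hθ : ENNReal.ofReal (1 + θ₁) = 1 + ENNReal.ofReal θ₁ := by
          rw [ENNReal.ofReal_add zero_le_one h1, ENNReal.ofReal_one]
        rw [ENNReal.ofReal_mul (by positivity : 0 ≤ (1 + η) ^ 2),
          ENNReal.ofReal_mul (by positivity : 0 ≤ (1 + η) ^ 2), hη2,
          ENNReal.ofReal_add (mul_nonneg (by linarith) hρε) (mul_nonneg h2 hAε),
          ENNReal.ofReal_mul (by linarith : 0 ≤ 1 + θ₁), ENNReal.ofReal_mul h2, hθ,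
          ENNReal.ofReal_add hη0 hB]
        ring
    _ ≤ ENNReal.ofReal (α * r ^ ε) * V +
          ENNReal.ofReal ((1 + e) ^ 2 * (M * 2 ^ ε + b) * r ^ ε) * N := by
        gcongr ENNReal.ofReal ?_ * _ + ENNReal.ofReal ?_ * _
        · calc (1 + η) ^ 2 * ((1 + θ₁) * ((1 + e) * (r / σ)) ^ ε + θ₂ * A ^ ε)
              ≤ (1 + e) ^ 2 * ((1 + e) * κ * r ^ ε) := by gcongr
            _ = (1 + e) ^ 3 * κ * r ^ ε := by ring
            _ ≤ _ := by gcongr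
        · have h3 : η = M * 2 ^ ε * r ^ ε := by
            rw [hη, Real.mul_rpow (by norm_num) hr0.le]; ring
          calc (1 + η) ^ 2 * (η + B) ≤ (1 + e) ^ 2 * (η + B) := by gcongr
            _ ≤ (1 + e) ^ 2 * (M * 2 ^ ε * r ^ ε + b * r ^ ε) := by
              rw [← h3]; gcongr
            _ = _ := by ring
    _ = _ := by
        have hα0 : 0 ≤ α := by linarith
        rw [ENNReal.ofReal_mul hα0, ENNReal.ofReal_mul (by positivity)]; ring

theorem exists_varClass_frobeniusPerron_le {p : ℝ} (hp : 1 ≤ p) {τ : ℝ → ℝ} {q : ℕ}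
    {a : Fin (q + 1) → ℝ} {s : Fin q → ℝ} (hτ : IsPiecewiseExpanding (1 / p) τ a s) {σ : ℝ}
    (hσ : 1 < σ) (hσs : ∀ i, σ ≤ s i) {α : ℝ} (hα : σ ^ (-(1 / p)) + σ⁻¹ < α) :
    ∃ A₀ > (0 : ℝ), ∀ A ∈ Ioc (0 : ℝ) A₀, ∃ β > (0 : ℝ), ∀ f : ℝ → ℂ, MemLp f 1 lebI →
      varClass A p (frobeniusPerron τ a f) ≤
        ENNReal.ofReal α * varClass A p f + ENNReal.ofReal β * eLpNorm f 1 lebI := by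
  obtain ⟨A₀, hA₀, h⟩ := hτ.exists_varFun_frobeniusPerron_le hp hσ hσs hα
  refine ⟨A₀, hA₀, fun A hA => ?_⟩
  obtain ⟨β, hβ, h⟩ := h A hA
  refine ⟨β, hβ, fun f hf => ?_⟩
  have hσ0 : 0 < σ := by linarith
  have hα0 : 0 < α := lt_trans (by positivity) hα
  refine varClass_le_of_forall hα0 fun g hg => ?_
  refine (iInf₂_le (f := fun k (_ : k =ᵐ[lebI] frobeniusPerron τ a f) => varFun A p k) _
    (hτ.frobeniusPerron_congr_ae hg)).trans ?_
  rw [← eLpNorm_congr_ae hg]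
  exact h g (hf.1.congr hg.symm).aemeasurable

end IsPiecewiseExpanding

theorem theorem3p2p2 (p : ℝ) (hp : 1 ≤ p) (τ : ℝ → ℝ) (q : ℕ) (a : Fin (q + 1) → ℝ)
    (s : Fin q → ℝ) (hτ : IsPiecewiseExpanding (1 / p) τ a s)
    (σ : ℝ) (hσ : IsLeast (range s) σ) :
    -- for every choice of the constant `A` the operator is bounded in variation
    (∀ A : ℝ, 0 < A → ∃ α > (0 : ℝ), ∃ β > (0 : ℝ), ∀ f : ℝ → ℂ, MemBV A p f →
      MemBV A p (frobeniusPerron τ a f) ∧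
      varClass A p (frobeniusPerron τ a f) ≤
        ENNReal.ofReal α * varClass A p f + ENNReal.ofReal β * eLpNorm f 1 lebI) ∧
    -- for small `A` the factor may be any number above `σ^{-1/p} + σ^{-1}`
    (∀ α : ℝ, σ ^ (-(1 / p)) + σ⁻¹ < α → ∃ A₀ > (0 : ℝ), ∀ A ∈ Ioc (0 : ℝ) A₀,
      ∃ β > (0 : ℝ), ∀ f : ℝ → ℂ, MemBV A p f →
        varClass A p (frobeniusPerron τ a f) ≤
          ENNReal.ofReal α * varClass A p f + ENNReal.ofReal β * eLpNorm f 1 lebI) ∧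
    -- the Lasota–Yorke inequality
    (σ ^ (-(1 / p)) + σ⁻¹ < 1 → ∃ A₀ > (0 : ℝ), ∀ A ∈ Ioc (0 : ℝ) A₀,
      ∃ α : ℝ, 0 < α ∧ α < 1 ∧ ∃ K > (0 : ℝ), ∀ f : ℝ → ℂ, MemBV A p f →
        MemBV A p (frobeniusPerron τ a f) ∧
        bvNorm A p (frobeniusPerron τ a f) ≤
          ENNReal.ofReal α * bvNorm A p f + ENNReal.ofReal K * eLpNorm f 1 lebI) := by
  have hσ1 : 1 < σ := by
    obtain ⟨i, hi⟩ := hσ.1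
    rw [← hi]
    exact hτ.one_lt i
  have hσs : ∀ i, σ ≤ s i := fun i => hσ.2 (mem_range_self i)
  have hfin : ∀ {A C D : ℝ} {f : ℝ → ℂ} {X : ℝ≥0∞}, MemBV A p f →
      X ≤ ENNReal.ofReal C * varClass A p f + ENNReal.ofReal D * eLpNorm f 1 lebI → X < ∞ :=
    fun hf h => h.trans_lt (ENNReal.add_lt_top.2
      ⟨ENNReal.mul_lt_top ENNReal.ofReal_lt_top hf.2, ENNReal.mul_lt_top ENNReal.ofReal_lt_top hf.1.2⟩)
  refine ⟨fun A hA => ?_, fun α hα => ?_, fun hlt => ?_⟩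
  · have hσ0 : 0 < σ := by linarith
    set α := σ ^ (-(1 / p)) + σ⁻¹ + 1
    have hα0 : 0 < α := by positivity
    obtain ⟨A₀, hA₀, h⟩ := hτ.exists_varClass_frobeniusPerron_le hp hσ1 hσs (lt_add_one _)
    -- The estimate is applied at the admissible constant `min A A₀`. Comparability raises the left
    -- side to `A`, and monotonicity in `A` does the same on the right.
    obtain ⟨β, hβ, h⟩ := h (min A A₀) ⟨lt_min hA hA₀, min_le_right _ _⟩
    obtain ⟨C, hC, hCv⟩ := exists_varClass_le (A := A) hp (lt_min hA hA₀)
    refine ⟨C * α, by positivity, C * β, by positivity, fun f hf => ?_⟩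
    have hbound : varClass A p (frobeniusPerron τ a f) ≤
        ENNReal.ofReal (C * α) * varClass A p f + ENNReal.ofReal (C * β) * eLpNorm f 1 lebI := by
      calc _ ≤ ENNReal.ofReal C * (ENNReal.ofReal α * varClass (min A A₀) p f +
            ENNReal.ofReal β * eLpNorm f 1 lebI) :=
            (hCv _).trans (mul_le_mul' le_rfl (h f hf.1))
        _ ≤ ENNReal.ofReal C * (ENNReal.ofReal α * varClass A p f +
            ENNReal.ofReal β * eLpNorm f 1 lebI) := by
            gcongr
            exact varClass_mono (min_le_left _ _) f
        _ = _ := by rw [ENNReal.ofReal_mul hC.le, ENNReal.ofReal_mul hC.le]; ring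
    exact ⟨⟨hτ.memLp_frobeniusPerron hf.1, hfin hf hbound⟩, hbound⟩
  · obtain ⟨A₀, hA₀, h⟩ := hτ.exists_varClass_frobeniusPerron_le hp hσ1 hσs hα
    refine ⟨A₀, hA₀, fun A hA => ?_⟩
    obtain ⟨β, hβ, h⟩ := h A hA
    exact ⟨β, hβ, fun f hf => h f hf.1⟩
  · obtain ⟨α, hα, hα1⟩ := exists_between hlt
    have hσ0 : 0 < σ := by linarith
    have hα0 : 0 < α := lt_trans (by positivity) hα
    obtain ⟨A₀, hA₀, h⟩ := hτ.exists_varClass_frobeniusPerron_le hp hσ1 hσs hα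
    refine ⟨A₀, hA₀, fun A hA => ?_⟩
    obtain ⟨β, hβ, h⟩ := h A hA
    -- The extra `1` in `K` pays for the `L¹` part of the norm, by contraction.
    refine ⟨α, hα0, hα1, β + 1, by positivity, fun f hf => ?_⟩
    refine ⟨⟨hτ.memLp_frobeniusPerron hf.1, hfin hf (h f hf.1)⟩, ?_⟩
    calc bvNorm A p (frobeniusPerron τ a f)
        ≤ ENNReal.ofReal α * varClass A p f + ENNReal.ofReal β * eLpNorm f 1 lebI +
          eLpNorm f 1 lebI := add_le_add (h f hf.1) (hτ.eLpNorm_frobeniusPerron_le hf.1)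
      _ = ENNReal.ofReal α * varClass A p f + ENNReal.ofReal (β + 1) * eLpNorm f 1 lebI := by
          rw [ENNReal.ofReal_add hβ.le zero_le_one, ENNReal.ofReal_one]; ring
      _ ≤ _ := by
          unfold bvNorm
          gcongr
          exact le_self_add
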